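/- Let $d$ be a prime and let $\mathcal H=\mathbb C^d$ be a qudit with computational basis $|k\rangle$, $k\in\mathbb Z_d$, $X|k\rangle=|k+1\rangle$, $Z|k\rangle=\omega^k|k\rangle$, $\omega=e^{2\pi i/d}$, and Weyl operators $w(p,q)=\omega^{-2^{-1}pq}Z^pX^q$, extended to $n$ qudits by tensor products. A pure $n$-qudit stabilizer state is given by a unit vector fixed by $n$ commuting independent Pauli operators $\omega^{m}w(\vec p,\vec q)$; a state is a magic state if it is not a convex combination of pure stabilizer states. A Clifford unitary is a unitary that maps, under conjugation, every Weyl operator to a Weyl operator up to a phase. For $s,t\in\mathbb Z_d$ with $s^2+t^2\equiv1 \bmod d$, the discrete beam splitter on two $n$-qudit systems is $U_{s,t}=\sum_{\vec i,\vec j\in\mathbb Z_d^n}|s\vec i+t\vec j\rangle\langle\vec i|_A\otimes|-t\vec i+s\vec j\rangle\langle\vec j|_B$, and for an $n$-qudit state $\sigma$ let $\Lambda_{s,\sigma}(\rho)=\operatorname{Tr}_B\big[U_{s,t}(\rho\otimes\sigma)U_{s,t}^\dagger\big]$. The quantum capacity of a channel $\Lambda$ is $$Q(\Lambda)=\lim_{N\to\infty}\frac1N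 Q^{(1)}(\Lambda^{\otimes N}),\qquad Q^{(1)}(\Lambda)=\max_\rho\big[S(\Lambda(\rho))-S((I_R\otimes\Lambda)(|\Psi\rangle\langle\Psi|_{RA}))\big],$$ where $\rho$ ranges over the input states, $\Psi_{RA}$ is a purification of $\rho$, and $S(\rho)=-\operatorname{Tr}\rho\log_2\rho$. **Theorem.** There is a universal constant $c>0$ such that for every prime $d$ and all $s,t\in\mathbb Z_d$ with $s^2+t^2\equiv 1$ and $s^2,t^2\not\equiv0,1 \bmod d$, there is a pure single-qudit magic state $|\mathrm{magic}\rangle\in\mathbb C^d$ with the following property: for all integers $0\le k\le n$ and every $n$-qudit Clifford unitary $U_{\mathrm{cl}}$, the state $$\sigma_k=U_{\mathrm{cl}}\big(|\mathrm{magic}\rangle\langle\mathrm{magic}|^{\otimes k}\otimes|0\rangle\langle0|^{\otimes(n-k)}\big)U_{\mathrm{cl}}^\dagger$$ satisfies $Q(\Lambda_{s,\sigma_k})\ge kc$ (in particular, the limit that defines $Q(\Lambda_{s,\sigma_k})$ exists). -/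

import Mathlib

open Matrix Filter Topology
open scoped Kronecker ComplexOrder

noncomputable section

namespace QuditBeamSplitter

/-! ### States, entropy, channels in finite dimension

Operators on `ℂ^a` (`a` a finite index set) are matrices `Matrix a a ℂ`, vectors are functions
`a → ℂ`, and superoperators are linear maps between spaces of matrices. -/

section General

variable {a b r : Type} [Fintype a] [DecidableEq a] [Fintype b] [DecidableEq b]
  [Fintype r] [DecidableEq r]

/-- `ψ` is a unit vector. -/
def IsUnitVec (ψ : a → ℂ) : Prop := ∑ i, ‖ψ i‖ ^ 2 = 1

/-- The rank-one operator `|ψ⟩⟨ψ|`. -/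
def proj (ψ : a → ℂ) : Matrix a a ℂ := vecMulVec ψ (star ψ)

/-- `ρ` is a quantum state: positive semidefinite of trace one. -/
def IsState (ρ : Matrix a a ℂ) : Prop := ρ.PosSemidef ∧ ρ.trace = 1

/-- Partial trace over the second tensor factor. -/
def traceRight : Matrix (a × b) (a × b) ℂ →ₗ[ℂ] Matrix a a ℂ where
  toFun M := Matrix.of fun x x' => ∑ y, M (x, y) (x', y)
  map_add' M M' := by ext x x'; simp [Finset.sum_add_distrib]
  map_smul' z M := by ext x x'; simp [Finset.mul_sum]

/-- Partial trace over the first tensor factor. -/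
def traceLeft : Matrix (a × b) (a × b) ℂ →ₗ[ℂ] Matrix b b ℂ where
  toFun M := Matrix.of fun y y' => ∑ x, M (x, y) (x, y')
  map_add' M M' := by ext y y'; simp [Finset.sum_add_distrib]
  map_smul' z M := by ext y y'; simp [Finset.mul_sum]

open Classical in
/-- The von Neumann entropy `S(ρ) = - Tr (ρ log₂ ρ) = - ∑ λ log₂ λ`, the sum being over the
eigenvalues of the Hermitian matrix `ρ` with multiplicity (in bits; `0 log 0 = 0`).
It is used for states only. -/
def entropy (ρ : Matrix a a ℂ) : ℝ :=
  if h : ρ.IsHermitian then ∑ i, Real.negMulLog (h.eigenvalues i) / Real.log 2 else 0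

/-- `I_R ⊗ Λ`: apply `Λ` to each block `⟨k|_R M |l⟩_R` of `M`. -/
def idTensor (r : Type) (Λ : Matrix a a ℂ →ₗ[ℂ] Matrix b b ℂ) :
    Matrix (r × a) (r × a) ℂ →ₗ[ℂ] Matrix (r × b) (r × b) ℂ where
  toFun M := Matrix.of fun x y =>
    Λ (Matrix.of fun i j => M (x.1, i) (y.1, j)) x.2 y.2
  map_add' M M' := by
    ext x y
    exact congrFun (congrFun (map_add Λ (Matrix.of fun i j => M (x.1, i) (y.1, j))
      (Matrix.of fun i j => M' (x.1, i) (y.1, j))) x.2) y.2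
  map_smul' z M := by
    ext x y
    exact congrFun (congrFun (map_smul Λ z (Matrix.of fun i j => M (x.1, i) (y.1, j))) x.2) y.2

/-- `Λ^{⊗N}`, the linear map with
`|i₁…i_N⟩⟨j₁…j_N| ↦ Λ(|i₁⟩⟨j₁|) ⊗ ⋯ ⊗ Λ(|i_N⟩⟨j_N|)`. -/
def tensorPow (Λ : Matrix a a ℂ →ₗ[ℂ] Matrix b b ℂ) (N : ℕ) :
    Matrix (Fin N → a) (Fin N → a) ℂ →ₗ[ℂ] Matrix (Fin N → b) (Fin N → b) ℂ where
  toFun M := Matrix.of fun x y =>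
    ∑ i : Fin N → a, ∑ j : Fin N → a,
      M i j * ∏ m, Λ (Matrix.single (i m) (j m) 1) (x m) (y m)
  map_add' M M' := by ext x y; simp [add_mul, Finset.sum_add_distrib]
  map_smul' z M := by ext x y; simp [Finset.mul_sum, mul_assoc]

/-- The vector `Ψ` of `R ⊗ A` is a purification of `ρ`: `Tr_R |Ψ⟩⟨Ψ| = ρ`. -/
def IsPurification (Ψ : r × a → ℂ) (ρ : Matrix a a ℂ) : Prop := traceLeft (proj Ψ) = ρ

/-- The coherent information `S(Λ(ρ)) - S((I_R ⊗ Λ)(|Ψ⟩⟨Ψ|))`, for a purification `Ψ` of `ρ`. -/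
def coherentInfo (Λ : Matrix a a ℂ →ₗ[ℂ] Matrix b b ℂ) (ρ : Matrix a a ℂ) (Ψ : r × a → ℂ) : ℝ :=
  entropy (Λ ρ) - entropy (idTensor r Λ (proj Ψ))

/-- `Q⁽¹⁾(Λ)`: the maximum of the coherent information over all input states `ρ`. A reference
system `R` of the dimension of the input purifies every `ρ`, and the value does not depend on
the purification. -/
def oneShotCapacity (Λ : Matrix a a ℂ →ₗ[ℂ] Matrix b b ℂ) : ℝ :=
  sSup {x : ℝ | ∃ (ρ : Matrix a a ℂ) (Ψ : a × a → ℂ),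
    IsState ρ ∧ IsPurification Ψ ρ ∧ x = coherentInfo Λ ρ Ψ}

/-- The sequence `Q⁽¹⁾(Λ^{⊗N}) / N`. -/
def capacityRate (Λ : Matrix a a ℂ →ₗ[ℂ] Matrix b b ℂ) (N : ℕ) : ℝ :=
  oneShotCapacity (tensorPow Λ N) / N

/-- The quantum capacity `Q(Λ) = lim_{N → ∞} Q⁽¹⁾(Λ^{⊗N}) / N`. -/
def quantumCapacity (Λ : Matrix a a ℂ →ₗ[ℂ] Matrix b b ℂ) : ℝ :=
  limUnder atTop (capacityRate Λ)

end General

/-! ### Qudits, Weyl operators, stabilizer states, Clifford unitaries -/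

/-- Labels of the computational basis of `n` qudits of local dimension `d`. -/
abbrev Reg (d n : ℕ) : Type := Fin n → ZMod d

section Qudits

variable {d : ℕ} [NeZero d] {n : ℕ}

/-- `X |k⟩ = |k + 1⟩`. -/
def pauliX (d : ℕ) [NeZero d] : Matrix (ZMod d) (ZMod d) ℂ :=
  Matrix.of fun x k => if x = k + 1 then 1 else 0

/-- `Z |k⟩ = ω^k |k⟩` with `ω = exp (2πi / d)`. -/
def pauliZ (d : ℕ) [NeZero d] : Matrix (ZMod d) (ZMod d) ℂ :=
  Matrix.diagonal fun k => ZMod.stdAddChar k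

/-- The one-qudit Weyl operator `w(p,q) = ω^{-2⁻¹pq} Z^p X^q`. -/
def weylOne (p q : ZMod d) : Matrix (ZMod d) (ZMod d) ℂ :=
  (ZMod.stdAddChar (-(2⁻¹ * p * q)) : ℂ) • (pauliZ d ^ p.val * pauliX d ^ q.val)

/-- The `n`-qudit Weyl operator `w(p,q) = w(p₁,q₁) ⊗ ⋯ ⊗ w(p_n,q_n)`. -/
def weyl (p q : Reg d n) : Matrix (Reg d n) (Reg d n) ℂ :=
  Matrix.of fun x y => ∏ j, weylOne (p j) (q j) (x j) (y j)

/-- The product vector `v₁ ⊗ ⋯ ⊗ v_n`. -/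
def prodVec (v : Fin n → ZMod d → ℂ) : Reg d n → ℂ := fun x => ∏ j, v j (x j)

/-- A pure `n`-qudit stabilizer vector: a unit vector fixed by `n` commuting, independent Pauli
operators `g_j = ω^{m_j} w(p_j, q_j)`. -/
def IsStabilizerVec (ψ : Reg d n → ℂ) : Prop :=
  IsUnitVec ψ ∧ ∃ (m : Fin n → ZMod d) (pq : Fin n → Reg d n × Reg d n),
    LinearIndependent (ZMod d) pq ∧
    (∀ i j, Commute (weyl (pq i).1 (pq i).2) (weyl (pq j).1 (pq j).2)) ∧
    ∀ j, ((ZMod.stdAddChar (m j) : ℂ) • weyl (pq j).1 (pq j).2) *ᵥ ψ = ψ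

/-- `STAB`: the convex combinations of pure `n`-qudit stabilizer states. -/
def STAB (d n : ℕ) [NeZero d] : Set (Matrix (Reg d n) (Reg d n) ℂ) :=
  convexHull ℝ {ρ | ∃ ψ : Reg d n → ℂ, IsStabilizerVec ψ ∧ ρ = proj ψ}

/-- A pure one-qudit magic state: a unit vector whose state is not in `STAB`. -/
def IsMagicVec (φ : ZMod d → ℂ) : Prop :=
  IsUnitVec φ ∧ proj (prodVec fun _ : Fin 1 => φ) ∉ STAB d 1

/-- A Clifford unitary: it maps every Weyl operator to a Weyl operator, up to a phase,
under conjugation. -/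
def IsClifford (U : Matrix (Reg d n) (Reg d n) ℂ) : Prop :=
  U ∈ Matrix.unitaryGroup (Reg d n) ℂ ∧
    ∀ p q : Reg d n, ∃ (p' q' : Reg d n) (z : ℂ), ‖z‖ = 1 ∧ U * weyl p q * Uᴴ = z • weyl p' q'

/-- The `n`-qudit vector `|φ⟩^{⊗k} ⊗ |0⟩^{⊗(n-k)}`, for `k ≤ n`. -/
def paddedVec (n k : ℕ) (φ : ZMod d → ℂ) : Reg d n → ℂ :=
  prodVec fun j => if (j : ℕ) < k then φ else Pi.single 0 1

/-! ### The discrete beam splitter -/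

/-- Nontrivial parameters: `s² + t² ≡ 1` and `s², t² ≢ 0, 1` modulo `d`. -/
def NontrivialParams (s t : ZMod d) : Prop :=
  s ^ 2 + t ^ 2 = 1 ∧ s ^ 2 ≠ 0 ∧ s ^ 2 ≠ 1 ∧ t ^ 2 ≠ 0 ∧ t ^ 2 ≠ 1

/-- `U_{s,t} = ∑_{i,j} |s i + t j⟩⟨i|_A ⊗ |-t i + s j⟩⟨j|_B`. -/
def beamSplitter (n : ℕ) (s t : ZMod d) : Matrix (Reg d n × Reg d n) (Reg d n × Reg d n) ℂ :=
  ∑ i : Reg d n, ∑ j : Reg d n,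
    Matrix.single (s • i + t • j) i 1 ⊗ₖ Matrix.single (-(t • i) + s • j) j 1

/-- `Λ_{s,σ}(ρ) = Tr_B (U_{s,t} (ρ ⊗ σ) U_{s,t}†)`. -/
def beamSplitterChannel (s t : ZMod d) (σ : Matrix (Reg d n) (Reg d n) ℂ) :
    Matrix (Reg d n) (Reg d n) ℂ →ₗ[ℂ] Matrix (Reg d n) (Reg d n) ℂ where
  toFun ρ := traceRight (beamSplitter n s t * (ρ ⊗ₖ σ) * (beamSplitter n s t)ᴴ)
  map_add' ρ ρ' := by
    rw [Matrix.add_kronecker, Matrix.mul_add, Matrix.add_mul, map_add]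
  map_smul' z ρ := by
    rw [Matrix.smul_kronecker, Matrix.mul_smul, Matrix.smul_mul, map_smul, RingHom.id_apply]

end Qudits

end QuditBeamSplitter

end

open QuditBeamSplitter

noncomputable section

set_option linter.unusedSectionVars false

/-! A single use of the channel with a well-chosen input already has coherent information at least
`k * c`. Product inputs make `N ↦ Q⁽¹⁾(Λ^{⊗N})` superadditive, so Fekete's lemma yields the limit
and `Q ≥ Q⁽¹⁾` (`HasKraus.tendsto_capacityRate`).

The Clifford unitary is removed by rotating the input with the same Clifford. A Clifford acts
linearly on Weyl labels, and the beam splitter mixes the labels of its two inputs with the scalars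
`s`, `t`; these actions commute. Hence `U ⊗ U` passes through the beam splitter up to a product
unitary on output and environment (`IsClifford.exists_beamSplitter_mul_kronecker`), which changes no
entropy (`coherentInfo_mulVec`).

It remains to treat a product environment. For an input diagonal in the computational basis, output
and environment are both diagonal, and the coherent information is the Shannon entropy difference
`H(sI + tJ) - H(-tI + sJ)` for independent labels `I`, `J`, where `J` has the law given by the
squared amplitudes of the environment vector (`coherentInfo_diagPurification`). It is additive over
qudits, and zero for `I = J = 0`.

A positive gap independent of `d` comes from additive combinatorics. If `s² ≠ t²`, take `I ∈ s{0,1}`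
and `J ∈ t{0,1}` uniform: the output labels `s²a + t²b` are distinct, while the environment labels
`st(b - a)` collide. If `s² = t²`, take `I ∈ s{0,1,3}` and `J ∈ -t{0,1,3}`: the output sees
differences and the environment sums, and differences have more entropy. Nontrivial parameters force
`d ≥ 7`, so the law of `J` has at least two but fewer than `d` points in its support; no one-qudit
stabilizer state has such a support, so the vector is magic (`isMagicVec_of_support`). -/

namespace QuditBeamSplitter

/-! ### Von Neumann entropy: invariance, additivity, bounds -/

section Entropy

variable {a b r : Type} [Fintype a] [DecidableEq a] [Fintype b] [DecidableEq b]
  [Fintype r] [DecidableEq r]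

/-- The contribution `-λ log₂ λ` of an eigenvalue `λ` to the entropy. -/
def entropyTerm (z : ℂ) : ℝ := Real.negMulLog z.re / Real.log 2

lemma entropy_eq_sum {ρ : Matrix a a ℂ} (h : ρ.IsHermitian) :
    entropy ρ = ∑ i, Real.negMulLog (h.eigenvalues i) / Real.log 2 := by
  rw [entropy, dif_pos h]

/-- The eigenvalues are the roots of the characteristic polynomial, so entropies can be compared
through characteristic polynomials, without matching eigenbases. -/
lemma entropy_eq_sum_roots {ρ : Matrix a a ℂ} (h : ρ.IsHermitian) :
    entropy ρ = (ρ.charpoly.roots.map entropyTerm).sum := by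
  rw [entropy_eq_sum h, h.roots_charpoly_eq_eigenvalues, Multiset.map_map]
  simp [entropyTerm]

lemma entropy_eq_of_charpoly_eq {ρ : Matrix a a ℂ} {σ : Matrix b b ℂ} (hρ : ρ.IsHermitian)
    (hσ : σ.IsHermitian) (h : ρ.charpoly = σ.charpoly) : entropy ρ = entropy σ := by
  rw [entropy_eq_sum_roots hρ, entropy_eq_sum_roots hσ, h]

/-- The two marginals of a pure bipartite state have the same entropy. -/
lemma entropy_mul_conjTranspose_comm (M : Matrix a b ℂ) :
    entropy (M * Mᴴ) = entropy (Mᴴ * M) := by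
  rw [entropy_eq_sum_roots (isHermitian_mul_conjTranspose_self M),
    entropy_eq_sum_roots (isHermitian_conjTranspose_mul_self M)]
  have h := congrArg (fun p => (p.roots.map entropyTerm).sum) (charpoly_mul_comm' M Mᴴ)
  -- The two characteristic polynomials agree up to powers of `X`; the additional zero roots
  -- contribute `negMulLog 0 = 0`.
  have hx : ∀ (n : ℕ) (p : Polynomial ℂ), p.Monic →
      (((Polynomial.X ^ n * p).roots.map entropyTerm).sum) = (p.roots.map entropyTerm).sum := by
    intro n p hp
    rw [Polynomial.roots_mul (mul_ne_zero (pow_ne_zero _ Polynomial.X_ne_zero) hp.ne_zero),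
      Polynomial.roots_X_pow]
    simp [entropyTerm, Multiset.map_nsmul, Multiset.sum_nsmul]
  simpa only [hx _ _ (charpoly_monic _)] using h

lemma entropy_unitary_conj {ρ : Matrix a a ℂ} (h : ρ.IsHermitian) {U : Matrix a a ℂ}
    (hU : U ∈ unitaryGroup a ℂ) : entropy (U * ρ * Uᴴ) = entropy ρ := by
  refine entropy_eq_of_charpoly_eq (isHermitian_mul_mul_conjTranspose U h) h ?_
  rw [charpoly_mul_comm, ← Matrix.mul_assoc]
  have : Uᴴ * U = 1 := mem_unitaryGroup_iff'.mp hU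
  rw [this, Matrix.one_mul]

lemma entropy_submatrix {ρ : Matrix a a ℂ} (h : ρ.IsHermitian) (e : b ≃ a) :
    entropy (ρ.submatrix e e) = entropy ρ :=
  entropy_eq_of_charpoly_eq (h.submatrix e) h (charpoly_reindex e.symm ρ)

lemma isHermitian_diagonal_ofReal (f : a → ℝ) :
    (diagonal fun i => (f i : ℂ)).IsHermitian :=
  isHermitian_diagonal_of_self_adjoint _ (by ext i; simp)

lemma entropy_diagonal (f : a → ℝ) :
    entropy (diagonal fun i => (f i : ℂ)) = (∑ i, Real.negMulLog (f i)) / Real.log 2 := by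
  rw [entropy_eq_sum_roots (isHermitian_diagonal_ofReal f), charpoly_diagonal,
    Polynomial.roots_prod _ _ (Finset.prod_ne_zero_iff.mpr fun i _ => Polynomial.X_sub_C_ne_zero _)]
  simp [entropyTerm, Finset.sum_div]

lemma exists_unitary_diagonal {ρ : Matrix a a ℂ} (h : ρ.IsHermitian) :
    ∃ U ∈ unitaryGroup a ℂ, ρ = U * (diagonal fun i => (h.eigenvalues i : ℂ)) * Uᴴ := by
  refine ⟨h.eigenvectorUnitary, h.eigenvectorUnitary.2, ?_⟩
  conv_lhs => rw [h.spectral_theorem]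
  rfl

lemma sum_eigenvalues_eq_one {ρ : Matrix a a ℂ} (h : IsState ρ) :
    ∑ i, h.1.1.eigenvalues i = 1 := by
  have h2 := congrArg Complex.re (h.2.symm.trans h.1.1.trace_eq_sum_eigenvalues)
  simpa using h2.symm

lemma kronecker_mem_unitaryGroup {U : Matrix a a ℂ} {V : Matrix b b ℂ}
    (hU : U ∈ unitaryGroup a ℂ) (hV : V ∈ unitaryGroup b ℂ) :
    U ⊗ₖ V ∈ unitaryGroup (a × b) ℂ := by
  rw [mem_unitaryGroup_iff, star_eq_conjTranspose, conjTranspose_kronecker, ← mul_kronecker_mul]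
  rw [mem_unitaryGroup_iff, star_eq_conjTranspose] at hU hV
  rw [hU, hV, one_kronecker_one]

/-- After diagonalizing both factors this is `negMulLog (x * y) = y * negMulLog x + x * negMulLog
y`, summed over eigenvalues of total weight one. -/
lemma entropy_kronecker {ρ : Matrix a a ℂ} {σ : Matrix b b ℂ} (hρ : IsState ρ)
    (hσ : IsState σ) : entropy (ρ ⊗ₖ σ) = entropy ρ + entropy σ := by
  obtain ⟨U, hU, h1⟩ := exists_unitary_diagonal hρ.1.1
  obtain ⟨V, hV, h2⟩ := exists_unitary_diagonal hσ.1.1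
  rw [entropy_eq_sum hρ.1.1, entropy_eq_sum hσ.1.1]
  have s1 := sum_eigenvalues_eq_one hρ
  have s2 := sum_eigenvalues_eq_one hσ
  generalize hρ.1.1.eigenvalues = f at *
  generalize hσ.1.1.eigenvalues = g at *
  have hd : (diagonal fun i => (f i : ℂ)) ⊗ₖ (diagonal fun i => (g i : ℂ)) =
      diagonal fun p : a × b => ((f p.1 * g p.2 : ℝ) : ℂ) := by
    rw [diagonal_kronecker_diagonal]; simp
  rw [h1, h2, mul_kronecker_mul, mul_kronecker_mul, ← conjTranspose_kronecker, hd,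
    entropy_unitary_conj (isHermitian_diagonal_ofReal _) (kronecker_mem_unitaryGroup hU hV),
    entropy_diagonal, ← Finset.sum_div, ← Finset.sum_div, ← add_div, Fintype.sum_prod_type]
  congr 1
  simp_rw [Real.negMulLog_mul, Finset.sum_add_distrib, ← Finset.mul_sum, ← Finset.sum_mul, s1,
    s2, one_mul]

lemma isState_kronecker {ρ : Matrix a a ℂ} {σ : Matrix b b ℂ} (hρ : IsState ρ)
    (hσ : IsState σ) : IsState (ρ ⊗ₖ σ) :=
  ⟨hρ.1.kronecker hσ.1, by rw [trace_kronecker, hρ.2, hσ.2, one_mul]⟩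

lemma isState_submatrix {ρ : Matrix a a ℂ} (h : IsState ρ) (e : b ≃ a) :
    IsState (ρ.submatrix e e) := by
  refine ⟨h.1.submatrix e, ?_⟩
  rw [← h.2]
  exact Equiv.sum_comp e fun i => ρ i i

lemma entropy_nonneg {ρ : Matrix a a ℂ} (h : IsState ρ) : 0 ≤ entropy ρ := by
  rw [entropy_eq_sum h.1.1]
  refine Finset.sum_nonneg fun i _ => div_nonneg (Real.negMulLog_nonneg ?_ ?_)
    (Real.log_nonneg (by norm_num))
  · exact h.1.eigenvalues_nonneg i
  · rw [← sum_eigenvalues_eq_one h]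
    exact Finset.single_le_sum (f := h.1.1.eigenvalues)
      (fun j _ => h.1.eigenvalues_nonneg j) (Finset.mem_univ i)

/-- Pointwise Gibbs inequality against the weight `1 / D`, from `log u ≤ u - 1` at `u = 1 / (D x)`.
The corrections `1 / D - x` cancel when summed over a distribution on `D` points. -/
lemma negMulLog_le_mul_log_add {x D : ℝ} (hx : 0 ≤ x) (hD : 0 < D) :
    Real.negMulLog x ≤ x * Real.log D + (1 / D - x) := by
  rcases hx.eq_or_lt with rfl | hx
  · simpa using hD.le
  · have h := Real.log_le_sub_one_of_pos (show 0 < 1 / (D * x) by positivity)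
    rw [one_div, Real.log_inv, Real.log_mul hD.ne' hx.ne'] at h
    have h2 := mul_le_mul_of_nonneg_left h hx.le
    have h3 : x * ((D * x)⁻¹ - 1) = 1 / D - x := by field_simp
    rw [h3] at h2
    rw [Real.negMulLog]
    linarith

lemma entropy_le_log_card {ρ : Matrix a a ℂ} (h : IsState ρ) :
    entropy ρ ≤ Real.log (Fintype.card a) / Real.log 2 := by
  have hs := sum_eigenvalues_eq_one h
  have hne : Nonempty a := by
    by_contra hne
    rw [not_nonempty_iff] at hne
    simp at hs
  have hD : (0 : ℝ) < Fintype.card a := by exact_mod_cast Fintype.card_pos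
  rw [entropy_eq_sum h.1.1, ← Finset.sum_div]
  refine div_le_div_of_nonneg_right ?_ (Real.log_nonneg (by norm_num))
  refine (Finset.sum_le_sum fun i _ =>
    negMulLog_le_mul_log_add (h.1.eigenvalues_nonneg i) hD).trans ?_
  rw [Finset.sum_add_distrib, Finset.sum_sub_distrib, ← Finset.sum_mul, hs]
  simp [hD.ne']

end Entropy

/-! ### Kraus operators and bounds on the coherent information -/

section Channels

variable {a b r κ : Type} [Fintype a] [DecidableEq a] [Fintype b] [DecidableEq b]
  [Fintype r] [DecidableEq r] [Fintype κ]

/-- `K` is a family of Kraus operators of the channel `Λ`. -/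
def HasKraus (Λ : Matrix a a ℂ →ₗ[ℂ] Matrix b b ℂ) (K : κ → Matrix b a ℂ) : Prop :=
  (∀ M, Λ M = ∑ k, K k * M * (K k)ᴴ) ∧ ∑ k, (K k)ᴴ * K k = 1

variable {Λ : Matrix a a ℂ →ₗ[ℂ] Matrix b b ℂ} {K : κ → Matrix b a ℂ}

lemma HasKraus.isState_map (h : HasKraus Λ K) {ρ : Matrix a a ℂ} (hρ : IsState ρ) :
    IsState (Λ ρ) := by
  rw [h.1]
  refine ⟨posSemidef_sum _ fun k _ => hρ.1.mul_mul_conjTranspose_same (K k), ?_⟩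
  rw [trace_sum, ← hρ.2]
  simp_rw [fun k => trace_mul_comm (K k * ρ) (K k)ᴴ, ← Matrix.mul_assoc, ← trace_sum,
    ← Finset.sum_mul, h.2, Matrix.one_mul]

lemma HasKraus.apply_apply (h : HasKraus Λ K) (M : Matrix a a ℂ) (x y : b) :
    Λ M x y = ∑ k, ∑ i, ∑ j, K k x i * M i j * star (K k y j) := by
  rw [h.1, Matrix.sum_apply]
  refine Finset.sum_congr rfl fun k _ => ?_
  simp_rw [Matrix.mul_apply, Finset.sum_mul, conjTranspose_apply]
  exact Finset.sum_comm

lemma HasKraus.single_apply (h : HasKraus Λ K) (i j : a) (x y : b) :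
    Λ (Matrix.single i j 1) x y = ∑ k, K k x i * star (K k y j) := by
  rw [h.apply_apply]
  refine Finset.sum_congr rfl fun k _ => ?_
  rw [Finset.sum_eq_single i, Finset.sum_eq_single j]
  · simp
  · intro j' _ hj; simp [Matrix.single, hj.symm]
  · simp
  · intro i' _ hi; simp [Matrix.single, hi.symm]
  · simp

lemma HasKraus.sum_star_mul (h : HasKraus Λ K) (i j : a) :
    ∑ k, ∑ x, star (K k x i) * K k x j = if i = j then 1 else 0 := by
  have := congrFun (congrFun h.2 i) j
  rw [Matrix.sum_apply] at this
  simpa [Matrix.mul_apply, Matrix.one_apply] using this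

lemma hasKraus_of_apply (h1 : ∀ M x y, Λ M x y =
      ∑ k, ∑ i, ∑ j, K k x i * M i j * star (K k y j))
    (h2 : ∀ i j, ∑ k, ∑ x, star (K k x i) * K k x j = if i = j then 1 else 0) :
    HasKraus Λ K := by
  constructor
  · intro M
    ext x y
    rw [h1, Matrix.sum_apply]
    refine Finset.sum_congr rfl fun k _ => ?_
    simp_rw [Matrix.mul_apply, Finset.sum_mul, conjTranspose_apply]
    exact Finset.sum_comm
  · ext i j
    rw [Matrix.sum_apply]
    simpa [Matrix.mul_apply, Matrix.one_apply] using h2 i j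

/-- Complete positivity in Kraus form: it makes the reference-output matrix a state, so that the
entropy bounds apply to it. -/
lemma HasKraus.kraus_idTensor (h : HasKraus Λ K) :
    HasKraus (idTensor r Λ) (fun k => (1 : Matrix r r ℂ) ⊗ₖ K k) := by
  refine hasKraus_of_apply ?_ ?_
  · rintro M ⟨p, x⟩ ⟨q, y⟩
    change Λ (Matrix.of fun i j => M (p, i) (q, j)) x y = _
    rw [h.apply_apply]
    refine Finset.sum_congr rfl fun k _ => ?_
    simp_rw [Fintype.sum_prod_type, kroneckerMap_apply, Matrix.one_apply]
    simp only [ite_mul, one_mul, zero_mul, apply_ite (star : ℂ → ℂ), star_zero, mul_ite, mul_zero,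
      Finset.sum_ite_irrel, Finset.sum_const_zero, Finset.sum_ite_eq, Finset.mem_univ, if_true]
    rfl
  · rintro ⟨p, i⟩ ⟨q, j⟩
    simp_rw [Fintype.sum_prod_type, kroneckerMap_apply, Matrix.one_apply]
    have := h.sum_star_mul i j
    by_cases hpq : p = q
    · subst hpq
      simpa [Finset.sum_ite_irrel] using this
    · have hqp : q ≠ p := fun h => hpq h.symm
      simp [hpq, Finset.sum_ite_irrel, apply_ite (starRingEnd ℂ), hqp]

lemma HasKraus.kraus_tensorPow (h : HasKraus Λ K) (N : ℕ) :
    HasKraus (tensorPow Λ N)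
      (fun k : Fin N → κ => Matrix.of fun x i => ∏ m, K (k m) (x m) (i m)) := by
  classical
  refine hasKraus_of_apply ?_ ?_
  · intro M x y
    change ∑ i, ∑ j, M i j * ∏ m, Λ (Matrix.single (i m) (j m) 1) (x m) (y m) = _
    simp_rw [h.single_apply, Fintype.prod_sum, Finset.mul_sum]
    simp_rw [fun i => Finset.sum_comm (s := (Finset.univ : Finset (Fin N → a)))
      (t := (Finset.univ : Finset (Fin N → κ)))
      (f := fun j k => M i j * ∏ m, K (k m) (x m) (i m) * star (K (k m) (y m) (j m)))]
    rw [Finset.sum_comm]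
    refine Finset.sum_congr rfl fun k _ => Finset.sum_congr rfl fun i _ =>
      Finset.sum_congr rfl fun j _ => ?_
    rw [Finset.prod_mul_distrib]
    simp only [Matrix.of_apply, star_prod]
    ring
  · intro i j
    simp only [Matrix.of_apply, star_prod, ← Finset.prod_mul_distrib]
    rw [Finset.sum_congr rfl fun k _ =>
      (Fintype.prod_sum (fun m x => star (K (k m) x (i m)) * K (k m) x (j m))).symm]
    rw [← Fintype.prod_sum (fun m k => ∑ x, star (K k x (i m)) * K k x (j m))]
    simp_rw [h.sum_star_mul, Finset.prod_ite_zero]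
    simp [funext_iff]

lemma isState_proj {ψ : a → ℂ} (h : IsUnitVec ψ) : IsState (proj ψ) := by
  refine ⟨posSemidef_vecMulVec_self_star ψ, ?_⟩
  have : (∑ i, (‖ψ i‖ : ℂ) ^ 2) = 1 := by exact_mod_cast h
  rw [← this]
  exact Finset.sum_congr rfl fun i _ => Complex.mul_conj' (ψ i)

lemma trace_traceLeft (M : Matrix (r × a) (r × a) ℂ) : (traceLeft M).trace = M.trace := by
  simp only [Matrix.trace, Matrix.diag, traceLeft, LinearMap.coe_mk, AddHom.coe_mk,
    Matrix.of_apply]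
  rw [Fintype.sum_prod_type_right]

lemma IsPurification.isState_proj {Ψ : r × a → ℂ} {ρ : Matrix a a ℂ} (h : IsPurification Ψ ρ)
    (hρ : IsState ρ) : IsState (proj Ψ) := by
  refine ⟨posSemidef_vecMulVec_self_star Ψ, ?_⟩
  rw [← trace_traceLeft, show traceLeft (proj Ψ) = ρ from h, hρ.2]

/-- The subtracted entropy is nonnegative. The bound makes the supremum in `oneShotCapacity` a
genuine one rather than the default value of `sSup`. -/
lemma HasKraus.coherentInfo_le (h : HasKraus Λ K) {ρ : Matrix a a ℂ} {Ψ : r × a → ℂ}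
    (hρ : IsState ρ) (hΨ : IsPurification Ψ ρ) :
    coherentInfo Λ ρ Ψ ≤ Real.log (Fintype.card b) / Real.log 2 := by
  have h1 := entropy_le_log_card (h.isState_map hρ)
  have h2 := entropy_nonneg (h.kraus_idTensor.isState_map (hΨ.isState_proj hρ))
  rw [coherentInfo]
  linarith

/-- The set of values of the coherent information of `Λ`. -/
def coherentInfoSet (Λ : Matrix a a ℂ →ₗ[ℂ] Matrix b b ℂ) : Set ℝ :=
  {x : ℝ | ∃ (ρ : Matrix a a ℂ) (Ψ : a × a → ℂ),
    IsState ρ ∧ IsPurification Ψ ρ ∧ x = coherentInfo Λ ρ Ψ}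

lemma HasKraus.bddAbove_coherentInfoSet (h : HasKraus Λ K) : BddAbove (coherentInfoSet Λ) := by
  refine ⟨Real.log (Fintype.card b) / Real.log 2, ?_⟩
  rintro x ⟨ρ, Ψ, hρ, hΨ, rfl⟩
  exact h.coherentInfo_le hρ hΨ

lemma traceLeft_proj_apply (Ψ : r × a → ℂ) (x y : a) :
    traceLeft (proj Ψ) x y = ∑ p, Ψ (p, x) * star (Ψ (p, y)) := rfl

lemma coherentInfoSet_nonempty [Nonempty a] (Λ : Matrix a a ℂ →ₗ[ℂ] Matrix b b ℂ) :
    (coherentInfoSet Λ).Nonempty := by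
  obtain ⟨x⟩ := ‹Nonempty a›
  have hu : IsUnitVec (Pi.single (x, x) 1 : a × a → ℂ) := by
    rw [IsUnitVec, Finset.sum_eq_single (x, x)]
    · simp
    · intro y _ hy; simp [hy]
    · simp
  have hP := isState_proj hu
  refine ⟨_, traceLeft (proj (Pi.single (x, x) 1)), _, ⟨?_, ?_⟩, rfl, rfl⟩
  · have : traceLeft (proj (Pi.single (x, x) 1 : a × a → ℂ)) =
        ∑ p, vecMulVec (fun y => (Pi.single (x, x) 1 : a × a → ℂ) (p, y))
          (star fun y => (Pi.single (x, x) 1 : a × a → ℂ) (p, y)) := by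
      ext y z
      rw [Matrix.sum_apply]; rfl
    rw [this]
    exact posSemidef_sum _ fun p _ => posSemidef_vecMulVec_self_star _
  · rw [trace_traceLeft]; exact hP.2

lemma HasKraus.oneShotCapacity_le [Nonempty a] (h : HasKraus Λ K) :
    oneShotCapacity Λ ≤ Real.log (Fintype.card b) / Real.log 2 := by
  refine csSup_le (coherentInfoSet_nonempty Λ) ?_
  rintro x ⟨ρ, Ψ, hρ, hΨ, rfl⟩
  exact h.coherentInfo_le hρ hΨ

lemma HasKraus.coherentInfo_le_oneShotCapacity (h : HasKraus Λ K) {ρ : Matrix a a ℂ}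
    {Ψ : a × a → ℂ} (hρ : IsState ρ) (hΨ : IsPurification Ψ ρ) :
    coherentInfo Λ ρ Ψ ≤ oneShotCapacity Λ :=
  le_csSup h.bddAbove_coherentInfoSet ⟨ρ, Ψ, hρ, hΨ, rfl⟩

end Channels

/-! ### Superadditivity and existence of the capacity limit -/

section Capacity

variable {a b κ : Type} [Fintype a] [DecidableEq a] [Fintype b] [DecidableEq b] [Fintype κ]
  {Λ : Matrix a a ℂ →ₗ[ℂ] Matrix b b ℂ} {K : κ → Matrix b a ℂ}

lemma tensorPow_add_kronecker (Λ : Matrix a a ℂ →ₗ[ℂ] Matrix b b ℂ) (m n : ℕ)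
    (A : Matrix (Fin m → a) (Fin m → a) ℂ) (B : Matrix (Fin n → a) (Fin n → a) ℂ) :
    tensorPow Λ (m + n)
        ((A ⊗ₖ B).submatrix (Fin.appendEquiv m n).symm (Fin.appendEquiv m n).symm) =
      (tensorPow Λ m A ⊗ₖ tensorPow Λ n B).submatrix (Fin.appendEquiv m n).symm
        (Fin.appendEquiv m n).symm := by
  ext x y
  obtain ⟨⟨x₁, x₂⟩, rfl⟩ := (Fin.appendEquiv m n).surjective x
  obtain ⟨⟨y₁, y₂⟩, rfl⟩ := (Fin.appendEquiv m n).surjective y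
  simp only [submatrix_apply, Equiv.symm_apply_apply, kroneckerMap_apply]
  change ∑ i, ∑ j, _ * _ = (∑ i, ∑ j, _ * _) * ∑ i, ∑ j, _ * _
  rw [← (Fin.appendEquiv m n).sum_comp]
  simp_rw [← (Fin.appendEquiv m n).sum_comp (M := ℂ), Fintype.sum_prod_type, submatrix_apply,
    Equiv.symm_apply_apply, kroneckerMap_apply, Fin.prod_univ_add]
  simp only [Fin.appendEquiv, Equiv.coe_fn_mk, Fin.append_left, Fin.append_right]
  simp_rw [Finset.sum_mul, Finset.mul_sum]
  refine Finset.sum_congr rfl fun i _ => ?_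
  rw [Finset.sum_comm]
  refine Finset.sum_congr rfl fun j _ => Finset.sum_congr rfl fun i' _ =>
    Finset.sum_congr rfl fun j' _ => ?_
  ring

/-- The product of two bipartite vectors, as a vector on `m + n` copies. -/
def appendVec {m n : ℕ} (Ψ : (Fin m → a) × (Fin m → a) → ℂ)
    (Φ : (Fin n → a) × (Fin n → a) → ℂ) : (Fin (m + n) → a) × (Fin (m + n) → a) → ℂ :=
  fun p => Ψ (((Fin.appendEquiv m n).symm p.1).1, ((Fin.appendEquiv m n).symm p.2).1) *
    Φ (((Fin.appendEquiv m n).symm p.1).2, ((Fin.appendEquiv m n).symm p.2).2)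

variable {m n : ℕ} {ρ : Matrix (Fin m → a) (Fin m → a) ℂ} {σ : Matrix (Fin n → a) (Fin n → a) ℂ}
  {Ψ : (Fin m → a) × (Fin m → a) → ℂ} {Φ : (Fin n → a) × (Fin n → a) → ℂ}

lemma IsPurification.appendVec (hΨ : IsPurification Ψ ρ) (hΦ : IsPurification Φ σ) :
    IsPurification (appendVec Ψ Φ)
      ((ρ ⊗ₖ σ).submatrix (Fin.appendEquiv m n).symm (Fin.appendEquiv m n).symm) := by
  rw [IsPurification] at *
  subst hΨ hΦ
  ext x y
  rw [traceLeft_proj_apply, ← (Fin.appendEquiv m n).sum_comp, Fintype.sum_prod_type]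
  simp only [submatrix_apply, kroneckerMap_apply, traceLeft_proj_apply, Finset.sum_mul,
    Finset.mul_sum, QuditBeamSplitter.appendVec, Equiv.symm_apply_apply]
  rw [Finset.sum_comm]
  refine Finset.sum_congr rfl fun _ _ => Finset.sum_congr rfl fun _ _ => ?_
  rw [star_mul']
  ring

lemma idTensor_tensorPow_appendVec (Λ : Matrix a a ℂ →ₗ[ℂ] Matrix b b ℂ)
    (Ψ : (Fin m → a) × (Fin m → a) → ℂ) (Φ : (Fin n → a) × (Fin n → a) → ℂ) :
    idTensor (Fin (m + n) → a) (tensorPow Λ (m + n)) (proj (appendVec Ψ Φ)) =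
      (idTensor (Fin m → a) (tensorPow Λ m) (proj Ψ) ⊗ₖ
        idTensor (Fin n → a) (tensorPow Λ n) (proj Φ)).submatrix
        (((Fin.appendEquiv m n).symm.prodCongr (Fin.appendEquiv m n).symm).trans
          (Equiv.prodProdProdComm _ _ _ _))
        (((Fin.appendEquiv m n).symm.prodCongr (Fin.appendEquiv m n).symm).trans
          (Equiv.prodProdProdComm _ _ _ _)) := by
  ext ⟨p, x⟩ ⟨q, y⟩
  let e := (Fin.appendEquiv (α := a) m n).symm
  have h := congrFun (congrFun (tensorPow_add_kronecker Λ m n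
    (Matrix.of fun i j => proj Ψ ((e p).1, i) ((e q).1, j))
    (Matrix.of fun i j => proj Φ ((e p).2, i) ((e q).2, j))) x) y
  refine Eq.trans ?_ h
  change tensorPow Λ (m + n) _ x y = _
  refine congrArg (fun M => tensorPow Λ (m + n) M x y) ?_
  ext i j
  simp only [Matrix.of_apply, proj, vecMulVec_apply, appendVec, Pi.star_apply, submatrix_apply,
    kroneckerMap_apply, star_mul', e]
  ring

/-- On a product input, the output and the reference-output state are Kronecker products up to
relabelling, so both entropies add. -/
lemma HasKraus.coherentInfo_appendVec (h : HasKraus Λ K) (hρ : IsState ρ) (hσ : IsState σ)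
    (hΨ : IsPurification Ψ ρ) (hΦ : IsPurification Φ σ) :
    coherentInfo (tensorPow Λ (m + n))
        ((ρ ⊗ₖ σ).submatrix (Fin.appendEquiv m n).symm (Fin.appendEquiv m n).symm)
        (appendVec Ψ Φ) =
      coherentInfo (tensorPow Λ m) ρ Ψ + coherentInfo (tensorPow Λ n) σ Φ := by
  have h1 := (h.kraus_tensorPow m).isState_map hρ
  have h2 := (h.kraus_tensorPow n).isState_map hσ
  have h3 := (h.kraus_tensorPow m).kraus_idTensor (r := Fin m → a) |>.isState_map (hΨ.isState_proj hρ)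
  have h4 := (h.kraus_tensorPow n).kraus_idTensor (r := Fin n → a) |>.isState_map (hΦ.isState_proj hσ)
  rw [coherentInfo, tensorPow_add_kronecker, idTensor_tensorPow_appendVec,
    entropy_submatrix (isState_kronecker h1 h2).1.1,
    entropy_submatrix (isState_kronecker h3 h4).1.1, entropy_kronecker h1 h2,
    entropy_kronecker h3 h4, coherentInfo, coherentInfo]
  ring

lemma HasKraus.oneShotCapacity_add_le [Nonempty a] (h : HasKraus Λ K) (m n : ℕ) :
    oneShotCapacity (tensorPow Λ m) + oneShotCapacity (tensorPow Λ n) ≤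
      oneShotCapacity (tensorPow Λ (m + n)) := by
  have h1 : ∀ x ∈ coherentInfoSet (tensorPow Λ m), ∀ y ∈ coherentInfoSet (tensorPow Λ n),
      x + y ≤ oneShotCapacity (tensorPow Λ (m + n)) := by
    rintro x ⟨ρ, Ψ, hρ, hΨ, rfl⟩ y ⟨σ, Φ, hσ, hΦ, rfl⟩
    rw [← h.coherentInfo_appendVec hρ hσ hΨ hΦ]
    exact (h.kraus_tensorPow _).coherentInfo_le_oneShotCapacity
      (isState_submatrix (isState_kronecker hρ hσ) _) (hΨ.appendVec hΦ)
  rw [← le_sub_iff_add_le]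
  refine csSup_le (coherentInfoSet_nonempty _) fun x hx => ?_
  rw [le_sub_comm]
  refine csSup_le (coherentInfoSet_nonempty _) fun y hy => ?_
  rw [le_sub_iff_add_le']
  exact h1 x hx y hy

/-- The limit defining the quantum capacity exists, and it is at least `Q⁽¹⁾(Λ)`. -/
theorem HasKraus.tendsto_capacityRate [Nonempty a] [Nonempty b] (h : HasKraus Λ K) :
    Tendsto (capacityRate Λ) atTop (𝓝 (quantumCapacity Λ)) ∧
      oneShotCapacity (tensorPow Λ 1) ≤ quantumCapacity Λ := by
  -- Fekete's lemma is available for subadditive sequences, hence the sign.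
  have hsub : Subadditive fun N => -oneShotCapacity (tensorPow Λ N) := fun m n => by
    have := h.oneShotCapacity_add_le m n
    simp only
    linarith
  have hbdd : BddBelow (Set.range fun N : ℕ => -oneShotCapacity (tensorPow Λ N) / N) := by
    have hL : 0 ≤ Real.log (Fintype.card b) / Real.log 2 :=
      div_nonneg (Real.log_natCast_nonneg _) (Real.log_nonneg (by norm_num))
    refine ⟨-(Real.log (Fintype.card b) / Real.log 2), ?_⟩
    rintro _ ⟨N, rfl⟩
    simp only
    rcases Nat.eq_zero_or_pos N with rfl | hN
    · simpa using hL
    · have h1 := (h.kraus_tensorPow N).oneShotCapacity_le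
      rw [Fintype.card_fun, Fintype.card_fin, Nat.cast_pow, Real.log_pow] at h1
      have hN' : (0 : ℝ) < N := by exact_mod_cast hN
      rw [le_div_iff₀ hN']
      linarith [mul_div_assoc (N : ℝ) (Real.log (Fintype.card b)) (Real.log 2)]
  have ht := (hsub.tendsto_lim hbdd).neg
  have heq : (fun N : ℕ => -(-oneShotCapacity (tensorPow Λ N) / N)) = capacityRate Λ := by
    ext N
    rw [capacityRate, neg_div, neg_neg]
  rw [heq] at ht
  have hq : quantumCapacity Λ = -hsub.lim := ht.limUnder_eq
  refine ⟨hq ▸ ht, ?_⟩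
  -- The Fekete limit is an infimum; compare it with the term `N = 1`.
  have h1 := hsub.lim_le_div hbdd one_ne_zero
  rw [hq]
  simp only [Nat.cast_one, div_one] at h1
  linarith

lemma tensorPow_one_submatrix (Λ : Matrix a a ℂ →ₗ[ℂ] Matrix b b ℂ) (M : Matrix a a ℂ) :
    tensorPow Λ 1 (M.submatrix (Equiv.funUnique (Fin 1) a) (Equiv.funUnique (Fin 1) a)) =
      (Λ M).submatrix (Equiv.funUnique (Fin 1) b) (Equiv.funUnique (Fin 1) b) := by
  ext x y
  change ∑ i, ∑ j, _ * _ = _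
  simp_rw [← (Equiv.funUnique (Fin 1) a).symm.sum_comp (M := ℂ)]
  conv_rhs => rw [matrix_eq_sum_single M]
  simp only [map_sum, submatrix_apply, Matrix.sum_apply]
  refine Finset.sum_congr rfl fun i _ => Finset.sum_congr rfl fun j _ => ?_
  have : Matrix.single i j (M i j) = M i j • Matrix.single i j (1 : ℂ) := by
    rw [Matrix.smul_single]; simp
  rw [this, map_smul]
  simp

lemma HasKraus.coherentInfo_le_oneShotCapacity_tensorPow_one (h : HasKraus Λ K)
    {ρ : Matrix a a ℂ} {Ψ : a × a → ℂ} (hρ : IsState ρ) (hΨ : IsPurification Ψ ρ) :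
    coherentInfo Λ ρ Ψ ≤ oneShotCapacity (tensorPow Λ 1) := by
  let e := Equiv.funUnique (Fin 1) a
  let f := Equiv.funUnique (Fin 1) b
  have hP : IsPurification (fun p => Ψ (e p.1, e p.2)) (ρ.submatrix e e) := by
    ext x y
    rw [← show traceLeft (proj Ψ) = ρ from hΨ, traceLeft_proj_apply, submatrix_apply,
      traceLeft_proj_apply, ← e.sum_comp]
  refine le_trans (le_of_eq ?_) ((h.kraus_tensorPow 1).coherentInfo_le_oneShotCapacity
    (isState_submatrix hρ e) hP)
  have h2 : idTensor (Fin 1 → a) (tensorPow Λ 1) (proj fun p => Ψ (e p.1, e p.2)) =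
      (idTensor a Λ (proj Ψ)).submatrix (e.prodCongr f) (e.prodCongr f) := by
    ext ⟨p, x⟩ ⟨q, y⟩
    exact congrFun (congrFun (tensorPow_one_submatrix Λ
      (Matrix.of fun i j => proj Ψ (e p, i) (e q, j))) x) y
  rw [coherentInfo, coherentInfo, tensorPow_one_submatrix, h2,
    entropy_submatrix (h.isState_map hρ).1.1,
    entropy_submatrix (h.kraus_idTensor.isState_map (hΨ.isState_proj hρ)).1.1]

end Capacity

lemma isUnitVec_mulVec {a : Type} [Fintype a] [DecidableEq a] {U : Matrix a a ℂ}
    (hU : U ∈ unitaryGroup a ℂ) {ψ : a → ℂ} (hψ : IsUnitVec ψ) : IsUnitVec (U *ᵥ ψ) := by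
  have key : ∀ v : a → ℂ, ((∑ i, ‖v i‖ ^ 2 : ℝ) : ℂ) = star v ⬝ᵥ v := by
    intro v
    push_cast
    exact Finset.sum_congr rfl fun i _ => (Complex.conj_mul' (v i)).symm
  have h : ((∑ i, ‖(U *ᵥ ψ) i‖ ^ 2 : ℝ) : ℂ) = ((∑ i, ‖ψ i‖ ^ 2 : ℝ) : ℂ) := by
    rw [key, key, star_mulVec, dotProduct_mulVec, vecMul_vecMul,
      show Uᴴ * U = 1 from mem_unitaryGroup_iff'.mp hU, vecMul_one]
  rw [IsUnitVec] at *
  rw [hψ] at h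
  exact_mod_cast h

lemma conj_proj {a : Type} [Fintype a] [DecidableEq a] (U : Matrix a a ℂ) (ψ : a → ℂ) :
    U * proj ψ * Uᴴ = proj (U *ᵥ ψ) := by
  rw [proj, mul_vecMulVec, vecMulVec_mul, proj, star_mulVec]

/-! ### The beam splitter channel and its complementary output -/

section BeamSplitter

variable {d : ℕ} [NeZero d] {n : ℕ} {s t : ZMod d}

/-- The rotation of pairs of labels which is undone by the beam splitter. -/
def rotation (V : Type) [AddCommGroup V] [Module (ZMod d) V] (h : s ^ 2 + t ^ 2 = 1) :
    V × V ≃ V × V where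
  toFun p := (s • p.1 - t • p.2, t • p.1 + s • p.2)
  invFun p := (s • p.1 + t • p.2, -(t • p.1) + s • p.2)
  left_inv p := by
    refine Prod.ext ?_ ?_
    · calc _ = (s ^ 2 + t ^ 2) • p.1 := by simp only; module
        _ = p.1 := by rw [h, one_smul]
    · calc _ = (s ^ 2 + t ^ 2) • p.2 := by simp only; module
        _ = p.2 := by rw [h, one_smul]
  right_inv p := by
    refine Prod.ext ?_ ?_
    · calc _ = (s ^ 2 + t ^ 2) • p.1 := by simp only; module
        _ = p.1 := by rw [h, one_smul]
    · calc _ = (s ^ 2 + t ^ 2) • p.2 := by simp only; module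
        _ = p.2 := by rw [h, one_smul]

/-- The beam splitter permutes the computational basis, so multiplying by it only relabels rows or
columns. -/
lemma beamSplitter_eq (h : s ^ 2 + t ^ 2 = 1) :
    beamSplitter n s t = (1 : Matrix (Reg d n × Reg d n) _ ℂ).submatrix (rotation (Reg d n) h) id := by
  ext p ⟨i, j⟩
  rw [beamSplitter, Matrix.sum_apply, Finset.sum_eq_single i, Matrix.sum_apply,
    Finset.sum_eq_single j]
  · rw [submatrix_apply, Matrix.one_apply, kroneckerMap_apply, Matrix.single_apply,
      Matrix.single_apply, id]
    have : rotation (Reg d n) h p = (i, j) ↔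
        (s • i + t • j = p.1 ∧ i = i) ∧ (-(t • i) + s • j = p.2 ∧ j = j) := by
      rw [← Equiv.eq_symm_apply, Prod.ext_iff, eq_comm, @eq_comm _ p.2]
      simp [rotation]
    by_cases h1 : s • i + t • j = p.1 <;> by_cases h2 : -(t • i) + s • j = p.2 <;>
      simp [h1, h2, this]
  · intro j' _ hj
    simp [kroneckerMap_apply, Matrix.single_apply, hj]
  · simp
  · intro i' _ hi
    rw [Matrix.sum_apply]
    refine Finset.sum_eq_zero fun j' _ => ?_
    simp [kroneckerMap_apply, Matrix.single_apply, hi]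
  · simp

lemma beamSplitter_mul (h : s ^ 2 + t ^ 2 = 1)
    (M : Matrix (Reg d n × Reg d n) (Reg d n × Reg d n) ℂ) :
    beamSplitter n s t * M = M.submatrix (rotation (Reg d n) h) id := by
  rw [beamSplitter_eq h]
  ext p q
  simp [Matrix.mul_apply, Matrix.one_apply]

lemma mul_conjTranspose_beamSplitter (h : s ^ 2 + t ^ 2 = 1)
    (M : Matrix (Reg d n × Reg d n) (Reg d n × Reg d n) ℂ) :
    M * (beamSplitter n s t)ᴴ = M.submatrix id (rotation (Reg d n) h) := by
  rw [beamSplitter_eq h]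
  ext p q
  simp [Matrix.mul_apply, Matrix.one_apply]

lemma beamSplitter_mem_unitaryGroup (h : s ^ 2 + t ^ 2 = 1) :
    beamSplitter n s t ∈ unitaryGroup (Reg d n × Reg d n) ℂ := by
  rw [mem_unitaryGroup_iff, star_eq_conjTranspose, mul_conjTranspose_beamSplitter h,
    beamSplitter_eq h]
  ext p q
  simp [Matrix.one_apply]

lemma beamSplitterChannel_proj_apply (h : s ^ 2 + t ^ 2 = 1) (Φ : Reg d n → ℂ)
    (M : Matrix (Reg d n) (Reg d n) ℂ) (x x' : Reg d n) :
    beamSplitterChannel s t (proj Φ) M x x' =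
      ∑ y, M (rotation (Reg d n) h (x, y)).1 (rotation (Reg d n) h (x', y)).1 *
        (Φ (rotation (Reg d n) h (x, y)).2 * star (Φ (rotation (Reg d n) h (x', y)).2)) := by
  change traceRight (beamSplitter n s t * (M ⊗ₖ proj Φ) * (beamSplitter n s t)ᴴ) x x' = _
  rw [beamSplitter_mul h, mul_conjTranspose_beamSplitter h]
  rfl

/-- The operator with index `y` is `⟨y|_B U_{s,t} |Φ⟩_B`. Reindexing by the rotation reduces
completeness to the norm of `Φ`. -/
lemma hasKraus_beamSplitterChannel (h : s ^ 2 + t ^ 2 = 1) {Φ : Reg d n → ℂ}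
    (hΦ : IsUnitVec Φ) :
    HasKraus (beamSplitterChannel s t (proj Φ)) fun y : Reg d n => Matrix.of fun x i =>
      if i = (rotation (Reg d n) h (x, y)).1 then Φ (rotation (Reg d n) h (x, y)).2 else 0 := by
  refine hasKraus_of_apply ?_ ?_
  · intro M x x'
    rw [beamSplitterChannel_proj_apply h]
    refine Finset.sum_congr rfl fun y _ => ?_
    simp only [Matrix.of_apply, ite_mul, zero_mul, apply_ite (star : ℂ → ℂ), star_zero, mul_ite,
      mul_zero, Finset.sum_ite_eq', Finset.mem_univ, if_true]
    ring
  · intro i j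
    rw [Finset.sum_comm]
    have := (rotation (Reg d n) h).sum_comp fun p => star (if i = p.1 then Φ p.2 else 0) *
      (if j = p.1 then Φ p.2 else 0)
    rw [Fintype.sum_prod_type, Fintype.sum_prod_type] at this
    refine this.trans ?_
    by_cases hij : i = j
    · subst hij
      simp only [ite_mul, zero_mul, apply_ite (star : ℂ → ℂ), star_zero, mul_ite,
        mul_zero, Finset.sum_ite_irrel, Finset.sum_const_zero, Finset.sum_ite_eq, Finset.mem_univ,
        if_true]
      have h2 : ((∑ i, ‖Φ i‖ ^ 2 : ℝ) : ℂ) = 1 := by rw [show ∑ i, ‖Φ i‖ ^ 2 = 1 from hΦ]; simp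
      rw [← h2]
      push_cast
      exact Finset.sum_congr rfl fun i _ => Complex.conj_mul' (Φ i)
    · simp [hij, apply_ite (starRingEnd ℂ), Finset.sum_ite_irrel]

/-- The joint output amplitudes on the reference, the output and the environment, for the input
vector `Ψ` and the environment vector `Φ`. -/
def outputAmplitude (h : s ^ 2 + t ^ 2 = 1) (Ψ : Reg d n × Reg d n → ℂ) (Φ : Reg d n → ℂ)
    (r x y : Reg d n) : ℂ :=
  Ψ (r, (rotation (Reg d n) h (x, y)).1) * Φ (rotation (Reg d n) h (x, y)).2

lemma beamSplitterChannel_traceLeft_proj (h : s ^ 2 + t ^ 2 = 1) (Ψ : Reg d n × Reg d n → ℂ)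
    (Φ : Reg d n → ℂ) :
    beamSplitterChannel s t (proj Φ) (traceLeft (proj Ψ)) =
      (Matrix.of fun x (p : Reg d n × Reg d n) => outputAmplitude h Ψ Φ p.1 x p.2) *
        (Matrix.of fun x (p : Reg d n × Reg d n) => outputAmplitude h Ψ Φ p.1 x p.2)ᴴ := by
  ext x x'
  rw [beamSplitterChannel_proj_apply h, Matrix.mul_apply, Fintype.sum_prod_type, Finset.sum_comm]
  refine Finset.sum_congr rfl fun y _ => ?_
  rw [traceLeft_proj_apply, Finset.sum_mul]
  refine Finset.sum_congr rfl fun r _ => ?_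
  simp only [conjTranspose_apply, Matrix.of_apply, outputAmplitude, star_mul']
  ring

lemma idTensor_beamSplitterChannel_proj (h : s ^ 2 + t ^ 2 = 1) (Ψ : Reg d n × Reg d n → ℂ)
    (Φ : Reg d n → ℂ) :
    idTensor (Reg d n) (beamSplitterChannel s t (proj Φ)) (proj Ψ) =
      (Matrix.of fun (p : Reg d n × Reg d n) y => outputAmplitude h Ψ Φ p.1 p.2 y) *
        (Matrix.of fun (p : Reg d n × Reg d n) y => outputAmplitude h Ψ Φ p.1 p.2 y)ᴴ := by
  ext ⟨r, x⟩ ⟨r', x'⟩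
  change beamSplitterChannel s t (proj Φ) (Matrix.of fun i j => proj Ψ (r, i) (r', j)) x x' = _
  rw [beamSplitterChannel_proj_apply h, Matrix.mul_apply]
  refine Finset.sum_congr rfl fun y _ => ?_
  simp only [conjTranspose_apply, Matrix.of_apply, outputAmplitude, star_mul', proj,
    vecMulVec_apply, Pi.star_apply]
  ring

/-- The coherent information as the difference of the entropies of the output and of the
environment. -/
lemma coherentInfo_beamSplitterChannel (h : s ^ 2 + t ^ 2 = 1) (Ψ : Reg d n × Reg d n → ℂ)
    (Φ : Reg d n → ℂ) :
    coherentInfo (beamSplitterChannel s t (proj Φ)) (traceLeft (proj Ψ)) Ψ =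
      entropy ((Matrix.of fun x (p : Reg d n × Reg d n) => outputAmplitude h Ψ Φ p.1 x p.2) *
        (Matrix.of fun x (p : Reg d n × Reg d n) => outputAmplitude h Ψ Φ p.1 x p.2)ᴴ) -
      entropy ((Matrix.of fun (p : Reg d n × Reg d n) y => outputAmplitude h Ψ Φ p.1 p.2 y)ᴴ *
        (Matrix.of fun (p : Reg d n × Reg d n) y => outputAmplitude h Ψ Φ p.1 p.2 y)) := by
  -- The joint state of reference, output and environment is pure, so reference-output and
  -- environment have equal entropy.
  rw [coherentInfo, beamSplitterChannel_traceLeft_proj h, idTensor_beamSplitterChannel_proj h,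
    ← entropy_mul_conjTranspose_comm (Matrix.of fun (p : Reg d n × Reg d n) y =>
      outputAmplitude h Ψ Φ p.1 p.2 y)]

variable {U A B : Matrix (Reg d n) (Reg d n) ℂ}

lemma outputAmplitude_mulVec (h : s ^ 2 + t ^ 2 = 1)
    (hAB : beamSplitter n s t * (U ⊗ₖ U) = (A ⊗ₖ B) * beamSplitter n s t)
    (Ψ : Reg d n × Reg d n → ℂ) (Φ : Reg d n → ℂ) (r x y : Reg d n) :
    outputAmplitude h (fun p => ∑ i, U p.2 i * Ψ (p.1, i)) (U *ᵥ Φ) r x y =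
      ∑ x', ∑ y', A x x' * B y y' * outputAmplitude h Ψ Φ r x' y' := by
  have h1 := congrFun (congrArg (fun M => M *ᵥ fun p : Reg d n × Reg d n => Ψ (r, p.1) * Φ p.2)
    hAB) (x, y)
  simp only at h1
  rw [beamSplitter_mul h, ← mulVec_mulVec] at h1
  have h2 : (beamSplitter n s t *ᵥ fun p : Reg d n × Reg d n => Ψ (r, p.1) * Φ p.2) =
      fun p => outputAmplitude h Ψ Φ r p.1 p.2 := by
    ext p
    rw [beamSplitter_eq h]
    simp [mulVec, dotProduct, Matrix.one_apply, outputAmplitude]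
  rw [h2] at h1
  simp only [mulVec, dotProduct, Fintype.sum_prod_type, kroneckerMap_apply, submatrix_apply,
    id] at h1
  rw [← h1]
  simp only [outputAmplitude, mulVec, dotProduct, Finset.sum_mul, Finset.mul_sum]
  refine Finset.sum_comm.trans ?_
  refine Finset.sum_congr rfl fun i _ => Finset.sum_congr rfl fun j _ => ?_
  ring

/-- Rotating input and environment by `U` only applies `A` to the output and `B` to the outgoing
environment, and local unitaries preserve both entropies. -/
lemma coherentInfo_mulVec (h : s ^ 2 + t ^ 2 = 1) (hA : A ∈ unitaryGroup (Reg d n) ℂ)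
    (hB : B ∈ unitaryGroup (Reg d n) ℂ)
    (hAB : beamSplitter n s t * (U ⊗ₖ U) = (A ⊗ₖ B) * beamSplitter n s t)
    (Ψ : Reg d n × Reg d n → ℂ) (Φ : Reg d n → ℂ) :
    coherentInfo (beamSplitterChannel s t (proj (U *ᵥ Φ)))
        (traceLeft (proj fun p => ∑ i, U p.2 i * Ψ (p.1, i)))
        (fun p => ∑ i, U p.2 i * Ψ (p.1, i)) =
      coherentInfo (beamSplitterChannel s t (proj Φ)) (traceLeft (proj Ψ)) Ψ := by
  rw [coherentInfo_beamSplitterChannel h, coherentInfo_beamSplitterChannel h]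
  have h1 : (Matrix.of fun x (p : Reg d n × Reg d n) =>
      outputAmplitude h (fun p => ∑ i, U p.2 i * Ψ (p.1, i)) (U *ᵥ Φ) p.1 x p.2) =
      A * (Matrix.of fun x (p : Reg d n × Reg d n) => outputAmplitude h Ψ Φ p.1 x p.2) *
        ((1 : Matrix (Reg d n) (Reg d n) ℂ) ⊗ₖ Bᵀ) := by
    ext x ⟨r, y⟩
    rw [Matrix.of_apply, outputAmplitude_mulVec h hAB]
    simp only [Matrix.mul_apply, Fintype.sum_prod_type, kroneckerMap_apply, Matrix.one_apply,
      transpose_apply, Matrix.of_apply, ite_mul, zero_mul, one_mul, mul_ite, mul_zero,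
      Finset.sum_ite_irrel, Finset.sum_const_zero, Finset.sum_ite_eq', Finset.mem_univ, if_true,
      Finset.sum_mul]
    rw [Finset.sum_comm]
    refine Finset.sum_congr rfl fun _ _ => Finset.sum_congr rfl fun _ _ => ?_
    ring
  have h2 : (Matrix.of fun (p : Reg d n × Reg d n) y =>
      outputAmplitude h (fun p => ∑ i, U p.2 i * Ψ (p.1, i)) (U *ᵥ Φ) p.1 p.2 y) =
      ((1 : Matrix (Reg d n) (Reg d n) ℂ) ⊗ₖ A) *
        (Matrix.of fun (p : Reg d n × Reg d n) y => outputAmplitude h Ψ Φ p.1 p.2 y) * Bᵀ := by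
    ext ⟨r, x⟩ y
    rw [Matrix.of_apply, outputAmplitude_mulVec h hAB]
    simp only [Matrix.mul_apply, Fintype.sum_prod_type, kroneckerMap_apply, Matrix.one_apply,
      transpose_apply, Matrix.of_apply, ite_mul, zero_mul, one_mul,
      Finset.sum_ite_irrel, Finset.sum_const_zero, Finset.sum_ite_eq, Finset.mem_univ, if_true,
      Finset.sum_mul]
    rw [Finset.sum_comm]
    refine Finset.sum_congr rfl fun _ _ => Finset.sum_congr rfl fun _ _ => ?_
    ring
  have hBt : Bᵀ ∈ unitaryGroup (Reg d n) ℂ := by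
    rw [mem_unitaryGroup_iff']
    have := congrArg transpose (mem_unitaryGroup_iff.mp hB)
    rw [transpose_mul, transpose_one] at this
    exact this
  have hBs : Bᵀᴴ ∈ unitaryGroup (Reg d n) ℂ := Unitary.star_mem hBt
  have hkey1 : ∀ (L : Matrix (Reg d n) (Reg d n × Reg d n) ℂ)
      (V : Matrix (Reg d n × Reg d n) (Reg d n × Reg d n) ℂ), V ∈ unitaryGroup _ ℂ →
      (A * L * V) * (A * L * V)ᴴ = A * (L * Lᴴ) * Aᴴ := by
    intro L V hV
    have hV' : V * Vᴴ = 1 := mem_unitaryGroup_iff.mp hV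
    rw [conjTranspose_mul, Matrix.mul_assoc (A * L), ← Matrix.mul_assoc V, hV', Matrix.one_mul,
      conjTranspose_mul]
    simp only [Matrix.mul_assoc]
  have hkey2 : ∀ (L : Matrix (Reg d n × Reg d n) (Reg d n) ℂ)
      (V : Matrix (Reg d n × Reg d n) (Reg d n × Reg d n) ℂ), V ∈ unitaryGroup _ ℂ →
      (V * L * Bᵀ)ᴴ * (V * L * Bᵀ) = Bᵀᴴ * (Lᴴ * L) * Bᵀᴴᴴ := by
    intro L V hV
    have hV' : Vᴴ * V = 1 := mem_unitaryGroup_iff'.mp hV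
    rw [conjTranspose_mul, conjTranspose_mul, conjTranspose_conjTranspose]
    calc _ = Bᵀᴴ * (Lᴴ * ((Vᴴ * V) * L)) * Bᵀ := by simp only [Matrix.mul_assoc]
      _ = _ := by rw [hV', Matrix.one_mul]
  rw [h1, h2, hkey1 _ _ (kronecker_mem_unitaryGroup (one_mem _) hBt),
    hkey2 _ _ (kronecker_mem_unitaryGroup (one_mem _) hA),
    entropy_unitary_conj (isHermitian_mul_conjTranspose_self _) hA,
    entropy_unitary_conj (isHermitian_conjTranspose_mul_self _) hBs]

end BeamSplitter

/-! ### Calculus of equality up to a phase -/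

/-- Equality up to a phase. -/
def PhaseEq {a b : Type} (A B : Matrix a b ℂ) : Prop := ∃ z : ℂ, ‖z‖ = 1 ∧ A = z • B

section PhaseEq

variable {a b c e : Type} [Fintype a] [Fintype b] [Fintype c] [Fintype e]

lemma PhaseEq.refl (A : Matrix a b ℂ) : PhaseEq A A := ⟨1, by simp, by simp⟩

lemma PhaseEq.symm {A B : Matrix a b ℂ} (h : PhaseEq A B) : PhaseEq B A := by
  obtain ⟨z, hz, rfl⟩ := h
  have hz0 : z ≠ 0 := by rintro rfl; simp at hz
  exact ⟨z⁻¹, by simp [hz], by rw [smul_smul, inv_mul_cancel₀ hz0, one_smul]⟩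

lemma PhaseEq.trans {A B C : Matrix a b ℂ} (h : PhaseEq A B) (h' : PhaseEq B C) :
    PhaseEq A C := by
  obtain ⟨z, hz, rfl⟩ := h
  obtain ⟨w, hw, rfl⟩ := h'
  exact ⟨z * w, by simp [hz, hw], by rw [smul_smul]⟩

lemma PhaseEq.mul_left {A B : Matrix a b ℂ} (h : PhaseEq A B) (C : Matrix c a ℂ) :
    PhaseEq (C * A) (C * B) := by
  obtain ⟨z, hz, rfl⟩ := h
  exact ⟨z, hz, by rw [Matrix.mul_smul]⟩

lemma PhaseEq.mul_right {A B : Matrix a b ℂ} (h : PhaseEq A B) (C : Matrix b c ℂ) :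
    PhaseEq (A * C) (B * C) := by
  obtain ⟨z, hz, rfl⟩ := h
  exact ⟨z, hz, by rw [Matrix.smul_mul]⟩

lemma PhaseEq.kronecker {A B : Matrix a b ℂ} {C D : Matrix c e ℂ} (h : PhaseEq A B)
    (h' : PhaseEq C D) : PhaseEq (A ⊗ₖ C) (B ⊗ₖ D) := by
  obtain ⟨z, hz, rfl⟩ := h
  obtain ⟨w, hw, rfl⟩ := h'
  exact ⟨z * w, by simp [hz, hw], by rw [smul_kronecker, kronecker_smul, smul_smul]⟩

end PhaseEq

/-! ### Weyl operators and their conjugation by the beam splitter -/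

section Weyl

variable {d : ℕ} [NeZero d] {n : ℕ} {s t : ZMod d}

lemma norm_stdAddChar (x : ZMod d) : ‖(ZMod.stdAddChar x : ℂ)‖ = 1 :=
  AddChar.norm_apply _ _

lemma stdAddChar_sum {ι : Type} (u : Finset ι) (f : ι → ZMod d) :
    (ZMod.stdAddChar (∑ j ∈ u, f j) : ℂ) = ∏ j ∈ u, ZMod.stdAddChar (f j) := by
  classical
  induction u using Finset.induction_on with
  | empty => simp
  | insert j u hj ih => rw [Finset.sum_insert hj, Finset.prod_insert hj, AddChar.map_add_eq_mul, ih]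

lemma pauliZ_pow (m : ℕ) :
    pauliZ d ^ m = Matrix.diagonal fun k => (ZMod.stdAddChar ((m : ZMod d) * k) : ℂ) := by
  rw [pauliZ, Matrix.diagonal_pow]
  congr 1
  ext k
  rw [Pi.pow_apply, ← AddChar.map_nsmul_eq_pow, nsmul_eq_mul]

lemma pauliX_pow (m : ℕ) :
    pauliX d ^ m = Matrix.of fun x y : ZMod d => if x = y + m then (1 : ℂ) else 0 := by
  induction m with
  | zero => ext x y; simp [Matrix.one_apply]
  | succ m ih =>
    rw [pow_succ, ih]
    ext x y
    rw [Matrix.mul_apply, Finset.sum_eq_single (y + 1)]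
    · simp [pauliX, add_assoc, add_comm (1 : ZMod d)]
    · intro z _ hz; simp [pauliX, hz]
    · simp

lemma weylOne_apply (p q x y : ZMod d) :
    weylOne p q x y = ZMod.stdAddChar (-(2⁻¹ * p * q)) *
      if x = y + q then (ZMod.stdAddChar (p * x) : ℂ) else 0 := by
  rw [weylOne, pauliZ_pow, pauliX_pow, Matrix.smul_apply, Matrix.diagonal_mul]
  simp only [ZMod.natCast_val, ZMod.cast_id', id, Matrix.of_apply, smul_eq_mul, mul_ite, mul_one,
    mul_zero]

/-- The Weyl operator `Z^p X^q`, without the phase that makes it symmetric. -/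
def shiftOp (v : Reg d n × Reg d n) : Matrix (Reg d n) (Reg d n) ℂ :=
  Matrix.of fun x y => if x = y + v.2 then (ZMod.stdAddChar (v.1 ⬝ᵥ x) : ℂ) else 0

lemma phaseEq_weyl_shiftOp (p q : Reg d n) : PhaseEq (weyl p q) (shiftOp (p, q)) := by
  refine ⟨∏ j, ZMod.stdAddChar (-(2⁻¹ * p j * q j)), ?_, ?_⟩
  · rw [norm_prod]
    exact Finset.prod_eq_one fun j _ => norm_stdAddChar _
  · ext x y
    rw [weyl, Matrix.of_apply, Matrix.smul_apply, shiftOp, Matrix.of_apply, smul_eq_mul]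
    simp_rw [weylOne_apply]
    rw [Finset.prod_mul_distrib, Finset.prod_ite_zero]
    simp only [Finset.mem_univ, true_imp_iff, dotProduct, stdAddChar_sum, funext_iff,
      Pi.add_apply]

lemma shiftOp_mul (v w : Reg d n × Reg d n) :
    PhaseEq (shiftOp v * shiftOp w) (shiftOp (v + w)) := by
  refine ⟨ZMod.stdAddChar (-(w.1 ⬝ᵥ v.2)), norm_stdAddChar _, ?_⟩
  ext x y
  rw [Matrix.mul_apply, Finset.sum_eq_single (y + w.2)]
  · simp only [shiftOp, Matrix.of_apply, Matrix.smul_apply, smul_eq_mul, Prod.snd_add,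
      Prod.fst_add, if_true]
    by_cases h : x = y + w.2 + v.2
    · have h' : x = y + (v.2 + w.2) := by rw [h]; abel
      rw [if_pos h, if_pos h', ← AddChar.map_add_eq_mul, ← AddChar.map_add_eq_mul]
      congr 1
      rw [h]
      simp only [dotProduct_add, add_dotProduct]
      ring
    · have h' : ¬ x = y + (v.2 + w.2) := by rw [add_comm v.2, ← add_assoc]; exact h
      rw [if_neg h, if_neg h']; simp
  · intro z _ hz
    simp [shiftOp, hz]
  · simp

/-- The support determines the shift and the entries determine the character. This turns relations
up to phase into equations between labels. -/
lemma shiftOp_injective_of_phaseEq {v w : Reg d n × Reg d n}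
    (h : PhaseEq (shiftOp v) (shiftOp w)) : v = w := by
  obtain ⟨z, hz, h⟩ := h
  have h2 : v.2 = w.2 := by
    have := congrFun (congrFun h v.2) 0
    by_contra hne
    simp [shiftOp, hne] at this
    have h0 := norm_stdAddChar (v.1 ⬝ᵥ v.2)
    rw [this] at h0
    simp at h0
  have h1 : ∀ x, (ZMod.stdAddChar (v.1 ⬝ᵥ x) : ℂ) = z * ZMod.stdAddChar (w.1 ⬝ᵥ x) := by
    intro x
    simpa [shiftOp, h2] using congrFun (congrFun h x) (x - w.2)
  have hz1 : z = 1 := by simpa using (h1 0).symm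
  refine Prod.ext (funext fun j => ?_) h2
  have := h1 (Pi.single j 1)
  rw [hz1, one_mul] at this
  simpa using ZMod.injective_stdAddChar this

/-- The rotation is orthogonal because `s² + t² = 1`, so shifts and characters transform by the same
matrix. -/
lemma beamSplitter_mul_shiftOp (h : s ^ 2 + t ^ 2 = 1) (v w : Reg d n × Reg d n) :
    beamSplitter n s t * (shiftOp v ⊗ₖ shiftOp w) =
      (shiftOp (s • v + t • w) ⊗ₖ shiftOp (-(t • v) + s • w)) * beamSplitter n s t := by
  have h1 := beamSplitter_mul h (shiftOp v ⊗ₖ shiftOp w)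
  have hu : (beamSplitter n s t)ᴴ * beamSplitter n s t = 1 :=
    mem_unitaryGroup_iff'.mp (beamSplitter_mem_unitaryGroup h)
  have key : beamSplitter n s t * (shiftOp v ⊗ₖ shiftOp w) * (beamSplitter n s t)ᴴ =
      shiftOp (s • v + t • w) ⊗ₖ shiftOp (-(t • v) + s • w) := by
    rw [h1, mul_conjTranspose_beamSplitter h]
    ext ⟨x, y⟩ ⟨x', y'⟩
    simp only [submatrix_apply, id, kroneckerMap_apply, shiftOp, Matrix.of_apply, rotation,
      Equiv.coe_fn_mk, ite_mul, zero_mul, mul_ite, mul_zero]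
    rw [← ite_and, ← ite_and]
    have hiff : (t • x + s • y = t • x' + s • y' + w.2 ∧ s • x - t • y = s • x' - t • y' + v.2) ↔
        (y = y' + (-(t • v) + s • w).2 ∧ x = x' + (s • v + t • w).2) := by
      constructor
      · rintro ⟨e1, e2⟩
        constructor
        · ext j
          have e1 := congrFun e1 j
          have e2 := congrFun e2 j
          simp only [Pi.add_apply, Pi.sub_apply, Pi.smul_apply, smul_eq_mul, Pi.neg_apply,
            Prod.snd_add, Prod.snd_neg, Prod.smul_snd] at e1 e2 ⊢
          linear_combination s * e1 - t * e2 - (y j - y' j) * h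
        · ext j
          have e1 := congrFun e1 j
          have e2 := congrFun e2 j
          simp only [Pi.add_apply, Pi.sub_apply, Pi.smul_apply, smul_eq_mul, Prod.snd_add,
            Prod.smul_snd] at e1 e2 ⊢
          linear_combination t * e1 + s * e2 - (x j - x' j) * h
      · rintro ⟨e1, e2⟩
        constructor
        · ext j
          have e1 := congrFun e1 j
          have e2 := congrFun e2 j
          simp only [Pi.add_apply, Pi.smul_apply, smul_eq_mul, Pi.neg_apply,
            Prod.snd_add, Prod.snd_neg, Prod.smul_snd] at e1 e2 ⊢
          linear_combination s * e1 + t * e2 + w.2 j * h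
        · ext j
          have e1 := congrFun e1 j
          have e2 := congrFun e2 j
          simp only [Pi.add_apply, Pi.sub_apply, Pi.smul_apply, smul_eq_mul, Pi.neg_apply,
            Prod.snd_add, Prod.snd_neg, Prod.smul_snd] at e1 e2 ⊢
          linear_combination s * e2 - t * e1 + v.2 j * h
    simp only [hiff, ← AddChar.map_add_eq_mul]
    congr 2
    simp only [dotProduct_add, add_dotProduct, dotProduct_sub, dotProduct_smul, smul_dotProduct,
      smul_eq_mul, Prod.fst_add, Prod.fst_neg, Prod.smul_fst, neg_dotProduct]
    ring
  rw [← key, Matrix.mul_assoc, hu, Matrix.mul_one]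

end Weyl

/-! ### Clifford unitaries pass through the beam splitter -/

section Clifford

variable {d : ℕ} [NeZero d] {n : ℕ} {s t : ZMod d}

/-- Products of Weyl operators add labels up to phase, so the induced map on labels is additive, and
additive maps over `ZMod d` are linear. -/
lemma IsClifford.exists_linear {U : Matrix (Reg d n) (Reg d n) ℂ} (hU : IsClifford U) :
    ∃ M : Reg d n × Reg d n →ₗ[ZMod d] Reg d n × Reg d n,
      ∀ v, PhaseEq (U * shiftOp v) (shiftOp (M v) * U) := by
  have hUU : Uᴴ * U = 1 := mem_unitaryGroup_iff'.mp hU.1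
  have hUU' : U * Uᴴ = 1 := mem_unitaryGroup_iff.mp hU.1
  have h : ∀ v : Reg d n × Reg d n, ∃ w, PhaseEq (U * shiftOp v) (shiftOp w * U) := by
    intro v
    obtain ⟨p', q', z, hz, h⟩ := hU.2 v.1 v.2
    refine ⟨(p', q'), ?_⟩
    have h1 : PhaseEq (U * weyl v.1 v.2 * Uᴴ * U) (weyl p' q' * U) :=
      PhaseEq.mul_right ⟨z, hz, h⟩ U
    rw [Matrix.mul_assoc _ Uᴴ, hUU, Matrix.mul_one] at h1
    exact (((phaseEq_weyl_shiftOp v.1 v.2).symm.mul_left U).trans h1).trans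
      ((phaseEq_weyl_shiftOp p' q').mul_right U)
  choose M hM using h
  have hadd : ∀ v w, M (v + w) = M v + M w := by
    intro v w
    apply shiftOp_injective_of_phaseEq
    have h1 : PhaseEq (shiftOp (M (v + w)) * U) (shiftOp (M v + M w) * U) := by
      refine (hM (v + w)).symm.trans (((shiftOp_mul v w).symm.mul_left U).trans ?_)
      rw [← Matrix.mul_assoc]
      refine ((hM v).mul_right _).trans ?_
      rw [Matrix.mul_assoc]
      refine ((hM w).mul_left _).trans ?_
      rw [← Matrix.mul_assoc]
      exact (shiftOp_mul (M v) (M w)).mul_right U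
    have h2 := h1.mul_right Uᴴ
    rwa [Matrix.mul_assoc, Matrix.mul_assoc, hUU', Matrix.mul_one, Matrix.mul_one] at h2
  exact ⟨(AddMonoidHom.mk' M hadd).toZModLinearMap d, hM⟩

/-- The generalized permutation matrix with entry `f x` in row `x` and column `x + b`. -/
def monomialOp {a : Type} [AddGroup a] [DecidableEq a] (f : a → ℂ) (b : a) : Matrix a a ℂ :=
  Matrix.of fun x y => if y = x + b then f x else 0

lemma monomialOp_mem_unitaryGroup {a : Type} [AddGroup a] [Fintype a] [DecidableEq a] {f : a → ℂ}
    (hf : ∀ x, ‖f x‖ = 1) (b : a) : monomialOp f b ∈ unitaryGroup a ℂ := by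
  rw [mem_unitaryGroup_iff, star_eq_conjTranspose]
  ext x y
  rw [Matrix.mul_apply, Finset.sum_eq_single (x + b)]
  · simp only [monomialOp, Matrix.of_apply, if_true, conjTranspose_apply, add_left_inj,
      Matrix.one_apply]
    by_cases h : x = y
    · subst h
      have := Complex.mul_conj' (f x)
      rw [hf x] at this
      simpa using this
    · simp [h]
  · intro z _ hz
    simp [monomialOp, hz]
  · simp

/-- A unitary that commutes with all products of Weyl operators up to phases is a product. -/
lemma exists_kronecker_of_phaseEq_shiftOp
    {G : Matrix (Reg d n × Reg d n) (Reg d n × Reg d n) ℂ}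
    (hG : G ∈ unitaryGroup (Reg d n × Reg d n) ℂ)
    (h : ∀ v w, PhaseEq (G * (shiftOp v ⊗ₖ shiftOp w)) ((shiftOp v ⊗ₖ shiftOp w) * G)) :
    ∃ A ∈ unitaryGroup (Reg d n) ℂ, ∃ B ∈ unitaryGroup (Reg d n) ℂ, G = A ⊗ₖ B := by
  have hGG : G * Gᴴ = 1 := mem_unitaryGroup_iff.mp hG
  obtain ⟨x₀, y₀, h₀⟩ : ∃ x y, G x y ≠ 0 := by
    by_contra! hz
    have := congrFun (congrFun hGG 0) 0
    simp [Matrix.mul_apply, hz] at this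
  have hdiag : ∀ p : Reg d n, shiftOp (p, 0) =
      Matrix.diagonal fun x : Reg d n => (ZMod.stdAddChar (p ⬝ᵥ x) : ℂ) := by
    intro p
    ext x y
    by_cases hxy : x = y <;> simp [shiftOp, hxy]
  -- Commuting up to phase with the diagonal Weyl operators makes every character of `y - x`
  -- constant on the support of `G`, which confines it to one translate `y = x + b`.
  have hchar : ∀ p q : Reg d n, ∃ z : ℂ, ∀ x y, G x y ≠ 0 →
      (ZMod.stdAddChar (p ⬝ᵥ (y - x).1 + q ⬝ᵥ (y - x).2) : ℂ) = z := by
    intro p q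
    obtain ⟨z, -, hz⟩ := h (p, 0) (q, 0)
    refine ⟨z, fun x y hxy => ?_⟩
    have h1 := congrFun (congrFun hz x) y
    rw [hdiag, hdiag, diagonal_kronecker_diagonal, Matrix.mul_diagonal, Matrix.smul_apply,
      Matrix.diagonal_mul, ← AddChar.map_add_eq_mul, ← AddChar.map_add_eq_mul, smul_eq_mul,
      mul_comm (G x y), ← mul_assoc] at h1
    have h2 := mul_right_cancel₀ hxy h1
    have h3 : p ⬝ᵥ (y - x).1 + q ⬝ᵥ (y - x).2 =
        (p ⬝ᵥ y.1 + q ⬝ᵥ y.2) + -(p ⬝ᵥ x.1 + q ⬝ᵥ x.2) := by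
      simp only [Prod.fst_sub, Prod.snd_sub, dotProduct_sub]; ring
    rw [h3, AddChar.map_add_eq_mul, h2, mul_assoc, ← AddChar.map_add_eq_mul, add_neg_cancel,
      AddChar.map_zero_eq_one, mul_one]
  set b := y₀ - x₀ with hb
  have hsupp : ∀ x y, G x y ≠ 0 → y = x + b := by
    intro x y hxy
    have key : ∀ p q : Reg d n, p ⬝ᵥ (y - x).1 + q ⬝ᵥ (y - x).2 = p ⬝ᵥ b.1 + q ⬝ᵥ b.2 := by
      intro p q
      obtain ⟨z, hz⟩ := hchar p q
      exact ZMod.injective_stdAddChar ((hz x y hxy).trans (hz x₀ y₀ h₀).symm)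
    rw [← sub_eq_iff_eq_add']
    refine Prod.ext (funext fun j => ?_) (funext fun j => ?_)
    · simpa using key (Pi.single j 1) 0
    · simpa using key 0 (Pi.single j 1)
  -- Commuting up to phase with the shifts makes the entry at `x + q` a multiple of that at `x`,
  -- with a factor depending on `q` only.
  have hshift : ∀ q : Reg d n × Reg d n, ∃ z : ℂ, ‖z‖ = 1 ∧
      ∀ x, G (x + q) (x + q + b) = z * G x (x + b) := by
    intro q
    obtain ⟨z, hz1, hz⟩ := h (0, q.1) (0, q.2)
    refine ⟨z, hz1, fun x => ?_⟩
    have h1 := congrFun (congrFun hz (x + q)) (x + b)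
    have hT : shiftOp ((0, q.1) : Reg d n × Reg d n) ⊗ₖ shiftOp (0, q.2) =
        Matrix.of fun x y : Reg d n × Reg d n => if x = y + q then (1 : ℂ) else 0 := by
      ext ⟨x, x'⟩ ⟨y, y'⟩
      by_cases h1 : x = y + q.1 <;> by_cases h2 : x' = y' + q.2 <;>
        simp [shiftOp, h1, h2, Prod.ext_iff]
    rw [hT, Matrix.smul_apply, Matrix.mul_apply, Matrix.mul_apply, smul_eq_mul,
      Finset.sum_eq_single (x + b + q), Finset.sum_eq_single x] at h1
    · simpa [add_right_comm] using h1
    · intro y _ hy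
      simp [hy.symm]
    · simp
    · intro y _ hy
      simp [hy]
    · simp
  have hnorm : ∀ x, ‖G x (x + b)‖ = 1 := by
    intro x
    have h1 := congrFun (congrFun hGG x) x
    rw [Matrix.mul_apply, Finset.sum_eq_single (x + b), Matrix.one_apply_eq, conjTranspose_apply]
      at h1
    · have h2 := Complex.mul_conj' (G x (x + b))
      rw [show (starRingEnd ℂ) (G x (x + b)) = star (G x (x + b)) from rfl, h1] at h2
      have h3 : ‖G x (x + b)‖ ^ 2 = 1 := by exact_mod_cast h2.symm
      exact (pow_eq_one_iff_of_nonneg (norm_nonneg _) two_ne_zero).mp h3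
    · intro y _ hy
      have : G x y = 0 := by
        by_contra hne
        exact hy (hsupp x y hne)
      simp [this]
    · simp
  have hG0 : ∀ x, G x (x + b) ≠ 0 := fun x h0 => by
    have := hnorm x
    rw [h0] at this
    simp at this
  -- The entries thus factor over the two coordinates; the division removes the entry at `x₀`
  -- counted twice.
  refine ⟨monomialOp (fun x => G (x, x₀.2) ((x, x₀.2) + b)) b.1,
    monomialOp_mem_unitaryGroup (fun x => hnorm _) _,
    monomialOp (fun x => G (x₀.1, x) ((x₀.1, x) + b) / G x₀ (x₀ + b)) b.2,
    monomialOp_mem_unitaryGroup (fun x => by rw [norm_div, hnorm, hnorm, div_one]) _, ?_⟩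
  ext ⟨x, x'⟩ ⟨y, y'⟩
  rw [kroneckerMap_apply]
  simp only [monomialOp, Matrix.of_apply]
  by_cases hxy : (y, y') = (x, x') + b
  · have e1 : y = x + b.1 := congrArg Prod.fst hxy
    have e2 : y' = x' + b.2 := congrArg Prod.snd hxy
    rw [if_pos e1, if_pos e2, hxy]
    obtain ⟨z, -, hz⟩ := hshift (x - x₀.1, 0)
    have a1 := hz (x₀.1, x')
    have a2 := hz x₀
    have c1 : (x₀.1, x') + (x - x₀.1, 0) = (x, x') := by ext <;> simp
    have c2 : x₀ + (x - x₀.1, 0) = (x, x₀.2) := by ext <;> simp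
    rw [c1] at a1
    rw [c2] at a2
    rw [a1, a2, mul_div_assoc', eq_div_iff (hG0 x₀)]
    ring
  · have h1 : G (x, x') (y, y') = 0 := by
      by_contra hne
      exact hxy (hsupp _ _ hne)
    rw [h1]
    by_cases e1 : y = x + b.1
    · have e2 : ¬ y' = x' + b.2 := fun e2 => hxy (Prod.ext e1 e2)
      rw [if_neg e2, mul_zero]
    · rw [if_neg e1, zero_mul]

/-- Cliffords pass through the beam splitter, up to a product unitary. -/
lemma IsClifford.exists_beamSplitter_mul_kronecker (h : s ^ 2 + t ^ 2 = 1)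
    {U : Matrix (Reg d n) (Reg d n) ℂ} (hU : IsClifford U) :
    ∃ A ∈ unitaryGroup (Reg d n) ℂ, ∃ B ∈ unitaryGroup (Reg d n) ℂ,
      beamSplitter n s t * (U ⊗ₖ U) = (A ⊗ₖ B) * beamSplitter n s t := by
  obtain ⟨M, hM⟩ := hU.exists_linear
  have hW := kronecker_mem_unitaryGroup hU.1 hU.1
  have hS := beamSplitter_mem_unitaryGroup (n := n) h
  set W := U ⊗ₖ U with hWdef
  set S := beamSplitter n s t with hSdef
  have hWW : Wᴴ * W = 1 := mem_unitaryGroup_iff'.mp hW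
  have hWW' : W * Wᴴ = 1 := mem_unitaryGroup_iff.mp hW
  have hSS : Sᴴ * S = 1 := mem_unitaryGroup_iff'.mp hS
  have hSS' : S * Sᴴ = 1 := mem_unitaryGroup_iff.mp hS
  have hWT : ∀ v w, PhaseEq (W * (shiftOp v ⊗ₖ shiftOp w))
      ((shiftOp (M v) ⊗ₖ shiftOp (M w)) * W) := by
    intro v w
    rw [hWdef, ← mul_kronecker_mul, ← mul_kronecker_mul]
    exact (hM v).kronecker (hM w)
  -- On labels, `W` applies `M` to both factors and `S` combines them with scalars. These maps
  -- commute by linearity, so the group commutator fixes every Weyl product up to phase.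
  have hcomm : ∀ v w, PhaseEq ((Wᴴ * S * W * Sᴴ) * (shiftOp v ⊗ₖ shiftOp w))
      ((shiftOp v ⊗ₖ shiftOp w) * (Wᴴ * S * W * Sᴴ)) := by
    intro v' w'
    obtain ⟨v, w, hv, hw⟩ : ∃ v w, v' = s • v + t • w ∧ w' = -(t • v) + s • w := by
      refine ⟨s • v' - t • w', t • v' + s • w', ?_, ?_⟩
      · calc v' = (s ^ 2 + t ^ 2) • v' := by rw [h, one_smul]
          _ = _ := by module
      · calc w' = (s ^ 2 + t ^ 2) • w' := by rw [h, one_smul]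
          _ = _ := by module
    have hv' : M v' = s • M v + t • M w := by rw [hv, map_add, map_smul, map_smul]
    have hw' : M w' = -(t • M v) + s • M w := by
      rw [hw, map_add, map_neg, map_smul, map_smul]
    have e1 : Sᴴ * (shiftOp v' ⊗ₖ shiftOp w') = (shiftOp v ⊗ₖ shiftOp w) * Sᴴ := by
      have := beamSplitter_mul_shiftOp (n := n) h v w
      rw [← hv, ← hw, ← hSdef] at this
      calc Sᴴ * (shiftOp v' ⊗ₖ shiftOp w')
          = Sᴴ * ((shiftOp v' ⊗ₖ shiftOp w') * S) * Sᴴ := by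
            rw [Matrix.mul_assoc, Matrix.mul_assoc _ S, hSS', Matrix.mul_one]
        _ = _ := by rw [← this, ← Matrix.mul_assoc, hSS, Matrix.one_mul]
    have e2 : S * (shiftOp (M v) ⊗ₖ shiftOp (M w)) =
        (shiftOp (M v') ⊗ₖ shiftOp (M w')) * S := by
      rw [hv', hw']; exact beamSplitter_mul_shiftOp h _ _
    have e3 : PhaseEq (Wᴴ * (shiftOp (M v') ⊗ₖ shiftOp (M w')))
        ((shiftOp v' ⊗ₖ shiftOp w') * Wᴴ) := by
      have h1 := (((hWT v' w').symm.mul_left Wᴴ).mul_right Wᴴ)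
      rwa [← Matrix.mul_assoc, ← Matrix.mul_assoc, hWW, Matrix.one_mul, Matrix.mul_assoc,
        hWW', Matrix.mul_one] at h1
    have f1 : (Wᴴ * S * W * Sᴴ) * (shiftOp v' ⊗ₖ shiftOp w') =
        Wᴴ * S * (W * (shiftOp v ⊗ₖ shiftOp w)) * Sᴴ := by
      rw [Matrix.mul_assoc, e1]; simp only [Matrix.mul_assoc]
    have f2 : Wᴴ * S * ((shiftOp (M v) ⊗ₖ shiftOp (M w)) * W) * Sᴴ =
        Wᴴ * (shiftOp (M v') ⊗ₖ shiftOp (M w')) * (S * W * Sᴴ) := by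
      have : Wᴴ * S * ((shiftOp (M v) ⊗ₖ shiftOp (M w)) * W) * Sᴴ =
        Wᴴ * (S * (shiftOp (M v) ⊗ₖ shiftOp (M w))) * (W * Sᴴ) := by
        simp only [Matrix.mul_assoc]
      rw [this, e2]; simp only [Matrix.mul_assoc]
    rw [f1]
    refine (((hWT v w).mul_left _).mul_right _).trans ?_
    rw [f2]
    refine (e3.mul_right _).trans ?_
    simp only [Matrix.mul_assoc]
    exact PhaseEq.refl _
  have hGu : Wᴴ * S * W * Sᴴ ∈ unitaryGroup (Reg d n × Reg d n) ℂ :=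
    mul_mem (mul_mem (mul_mem (Unitary.star_mem hW) hS) hW) (Unitary.star_mem hS)
  obtain ⟨A, hA, B, hB, hAB⟩ := exists_kronecker_of_phaseEq_shiftOp hGu hcomm
  refine ⟨U * A, mul_mem hU.1 hA, U * B, mul_mem hU.1 hB, ?_⟩
  rw [mul_kronecker_mul, ← hAB, ← hWdef]
  calc S * W = (W * Wᴴ) * (S * W) * (Sᴴ * S) := by
        rw [hWW', hSS, Matrix.one_mul, Matrix.mul_one]
    _ = _ := by simp only [Matrix.mul_assoc]

end Clifford

/-! ### Diagonal inputs: reduction to Shannon entropies -/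

section ProductInput

variable {d : ℕ} [NeZero d] {n : ℕ} {s t : ZMod d}

/-- The law of the output label if the input labels have the weights `P` and `Q`. -/
def outLaw {V : Type} [AddCommGroup V] [Module (ZMod d) V] [Fintype V] (h : s ^ 2 + t ^ 2 = 1)
    (P Q : V → ℝ) (x : V) : ℝ :=
  ∑ y, P (rotation V h (x, y)).1 * Q (rotation V h (x, y)).2

/-- The law of the environment label if the input labels have the weights `P` and `Q`. -/
def envLaw {V : Type} [AddCommGroup V] [Module (ZMod d) V] [Fintype V] (h : s ^ 2 + t ^ 2 = 1)
    (P Q : V → ℝ) (y : V) : ℝ :=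
  ∑ x, P (rotation V h (x, y)).1 * Q (rotation V h (x, y)).2

lemma sum_outLaw {V : Type} [AddCommGroup V] [Module (ZMod d) V] [Fintype V]
    (h : s ^ 2 + t ^ 2 = 1) (P Q : V → ℝ) : ∑ x, outLaw h P Q x = (∑ x, P x) * ∑ x, Q x := by
  rw [Finset.sum_mul_sum, ← Fintype.sum_prod_type' (f := fun x y => P x * Q y),
    ← (rotation V h).sum_comp, Fintype.sum_prod_type]
  rfl

lemma sum_envLaw {V : Type} [AddCommGroup V] [Module (ZMod d) V] [Fintype V]
    (h : s ^ 2 + t ^ 2 = 1) (P Q : V → ℝ) : ∑ x, envLaw h P Q x = (∑ x, P x) * ∑ x, Q x := by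
  rw [Finset.sum_mul_sum, ← Fintype.sum_prod_type' (f := fun x y => P x * Q y),
    ← (rotation V h).sum_comp, Fintype.sum_prod_type, Finset.sum_comm]
  rfl

/-- The standard purification of the diagonal operator with entries `P`. -/
def diagPurification (P : Reg d n → ℝ) : Reg d n × Reg d n → ℂ :=
  fun p => if p.1 = p.2 then (√(P p.2) : ℂ) else 0

/-- The reference records the input label `r = s x - t y`. Since `s` is invertible, `r` and `y` fix
the output label `x`; since `t` is, `r` and `x` fix `y`. Hence both reduced matrices are diagonal.
-/
lemma coherentInfo_diagPurification (h : s ^ 2 + t ^ 2 = 1) (hs : IsUnit s) (ht : IsUnit t)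
    {P : Reg d n → ℝ} (hP : ∀ x, 0 ≤ P x) (Φ : Reg d n → ℂ) :
    coherentInfo (beamSplitterChannel s t (proj Φ)) (traceLeft (proj (diagPurification P)))
        (diagPurification P) =
      (∑ x, Real.negMulLog (outLaw h P (fun y => ‖Φ y‖ ^ 2) x) -
        ∑ x, Real.negMulLog (envLaw h P (fun y => ‖Φ y‖ ^ 2) x)) / Real.log 2 := by
  have hterm : ∀ x y : Reg d n, (√(P x) : ℂ) * Φ y * star ((√(P x) : ℂ) * Φ y) =
      ((P x * ‖Φ y‖ ^ 2 : ℝ) : ℂ) := by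
    intro x y
    have h1 := Complex.mul_conj' ((√(P x) : ℂ) * Φ y)
    rw [← starRingEnd_apply, h1, norm_mul, Complex.norm_real,
      Real.norm_of_nonneg (Real.sqrt_nonneg _)]
    norm_cast
    rw [mul_pow, Real.sq_sqrt (hP x)]
  have h1 : (Matrix.of fun x (p : Reg d n × Reg d n) =>
      outputAmplitude h (diagPurification P) Φ p.1 x p.2) *
      (Matrix.of fun x (p : Reg d n × Reg d n) =>
        outputAmplitude h (diagPurification P) Φ p.1 x p.2)ᴴ =
      diagonal fun x => ((outLaw h P (fun y => ‖Φ y‖ ^ 2) x : ℝ) : ℂ) := by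
    ext x x'
    rw [Matrix.mul_apply, Fintype.sum_prod_type, Finset.sum_comm, Matrix.diagonal_apply]
    simp only [Matrix.of_apply, conjTranspose_apply, outputAmplitude, diagPurification, ite_mul,
      zero_mul, Finset.sum_ite_eq', Finset.mem_univ, if_true]
    by_cases hx : x = x'
    · subst hx
      rw [if_pos rfl, outLaw]
      push_cast
      refine Finset.sum_congr rfl fun y _ => ?_
      rw [if_pos rfl, hterm]
      push_cast
      rfl
    · rw [if_neg hx]
      refine Finset.sum_eq_zero fun y _ => ?_
      have : ¬ (rotation (Reg d n) h (x, y)).1 = (rotation (Reg d n) h (x', y)).1 := by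
        intro he
        exact hx (hs.smul_left_cancel.mp (sub_left_injective he))
      rw [if_neg this]
      simp
  have h2 : (Matrix.of fun (p : Reg d n × Reg d n) y =>
      outputAmplitude h (diagPurification P) Φ p.1 p.2 y)ᴴ *
      (Matrix.of fun (p : Reg d n × Reg d n) y =>
        outputAmplitude h (diagPurification P) Φ p.1 p.2 y) =
      diagonal fun x => ((envLaw h P (fun y => ‖Φ y‖ ^ 2) x : ℝ) : ℂ) := by
    ext y y'
    rw [Matrix.mul_apply, Fintype.sum_prod_type, Finset.sum_comm, Matrix.diagonal_apply]
    simp only [Matrix.of_apply, conjTranspose_apply, outputAmplitude, diagPurification, ite_mul,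
      mul_ite, mul_zero, zero_mul, Finset.sum_ite_eq', Finset.mem_univ, if_true]
    by_cases hx : y = y'
    · subst hx
      rw [if_pos rfl, envLaw]
      push_cast
      refine Finset.sum_congr rfl fun x _ => ?_
      rw [if_pos rfl, mul_comm, hterm]
      push_cast
      rfl
    · rw [if_neg hx]
      refine Finset.sum_eq_zero fun x _ => ?_
      have : ¬ (rotation (Reg d n) h (x, y')).1 = (rotation (Reg d n) h (x, y)).1 := by
        intro he
        exact hx (ht.smul_left_cancel.mp (sub_right_injective he)).symm
      rw [if_neg this]
      simp
  rw [coherentInfo_beamSplitterChannel h, h1, h2, entropy_diagonal, entropy_diagonal, ← sub_div]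

lemma sum_prod_eq_prod_sum {n : ℕ} {V : Type} [Fintype V] (f : Fin n → V → ℝ) :
    ∑ x : Fin n → V, ∏ j, f j (x j) = ∏ j, ∑ v, f j v :=
  (Fintype.prod_sum f).symm

/-- Shannon entropy is additive on product distributions. -/
lemma sum_negMulLog_prod {V : Type} [Fintype V] {n : ℕ} (f : Fin n → V → ℝ)
    (hf : ∀ j, ∑ v, f j v = 1) :
    ∑ x : Fin n → V, Real.negMulLog (∏ j, f j (x j)) =
      ∑ j, ∑ v, Real.negMulLog (f j v) := by
  induction n with
  | zero => simp
  | succ n ih =>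
    rw [← (Fin.consEquiv fun _ => V).sum_comp, Fintype.sum_prod_type, Fin.sum_univ_succ]
    simp only [Fin.consEquiv_apply, Fin.prod_univ_succ, Fin.cons_zero, Fin.cons_succ,
      Real.negMulLog_mul, Finset.sum_add_distrib]
    have h1 := ih (fun j => f j.succ) fun j => hf _
    have h2 : ∑ x : Fin n → V, ∏ j, f j.succ (x j) = 1 := by
      rw [sum_prod_eq_prod_sum fun j => f j.succ]
      exact Finset.prod_eq_one fun j _ => hf _
    simp_rw [← Finset.mul_sum, ← Finset.sum_mul, h1, h2, hf, one_mul]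

lemma outLaw_prod (h : s ^ 2 + t ^ 2 = 1) (P Q : Fin n → ZMod d → ℝ) (x : Reg d n) :
    outLaw h (fun x => ∏ j, P j (x j)) (fun x => ∏ j, Q j (x j)) x =
      ∏ j, outLaw h (P j) (Q j) (x j) := by
  simp only [outLaw, ← Finset.prod_mul_distrib]
  exact sum_prod_eq_prod_sum fun j v =>
    P j (rotation (ZMod d) h (x j, v)).1 * Q j (rotation (ZMod d) h (x j, v)).2

lemma envLaw_prod (h : s ^ 2 + t ^ 2 = 1) (P Q : Fin n → ZMod d → ℝ) (y : Reg d n) :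
    envLaw h (fun x => ∏ j, P j (x j)) (fun x => ∏ j, Q j (x j)) y =
      ∏ j, envLaw h (P j) (Q j) (y j) := by
  simp only [envLaw, ← Finset.prod_mul_distrib]
  exact sum_prod_eq_prod_sum fun j v =>
    P j (rotation (ZMod d) h (v, y j)).1 * Q j (rotation (ZMod d) h (v, y j)).2

/-- The entropy of the output label minus the entropy of the environment label, in nats. -/
def labelGap (h : s ^ 2 + t ^ 2 = 1) (P Q : ZMod d → ℝ) : ℝ :=
  ∑ v, Real.negMulLog (outLaw h P Q v) - ∑ v, Real.negMulLog (envLaw h P Q v)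

lemma coherentInfo_prod (h : s ^ 2 + t ^ 2 = 1) (hs : IsUnit s) (ht : IsUnit t)
    {P : Fin n → ZMod d → ℝ} (hP : ∀ j x, 0 ≤ P j x) (hP1 : ∀ j, ∑ x, P j x = 1)
    {φ : Fin n → ZMod d → ℂ} (hφ : ∀ j, IsUnitVec (φ j)) :
    coherentInfo (beamSplitterChannel s t (proj (prodVec φ)))
        (traceLeft (proj (diagPurification fun x => ∏ j, P j (x j))))
        (diagPurification fun x => ∏ j, P j (x j)) =
      (∑ j, labelGap h (P j) fun v => ‖φ j v‖ ^ 2) / Real.log 2 := by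
  rw [coherentInfo_diagPurification h hs ht fun x => Finset.prod_nonneg fun j _ => hP j _]
  have hn : (fun x : Reg d n => ‖prodVec φ x‖ ^ 2) = fun x => ∏ j, ‖φ j (x j)‖ ^ 2 := by
    ext x
    rw [prodVec, norm_prod, Finset.prod_pow]
  simp only [hn, outLaw_prod h P fun j v => ‖φ j v‖ ^ 2, envLaw_prod h P fun j v => ‖φ j v‖ ^ 2]
  rw [sum_negMulLog_prod (fun j => outLaw h (P j) fun v => ‖φ j v‖ ^ 2), sum_negMulLog_prod
    (fun j => envLaw h (P j) fun v => ‖φ j v‖ ^ 2), ← Finset.sum_sub_distrib]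
  · rfl
  · intro j
    rw [sum_envLaw, hP1, hφ j, one_mul]
  · intro j
    rw [sum_outLaw, hP1, hφ j, one_mul]

lemma isUnitVec_prodVec {φ : Fin n → ZMod d → ℂ} (hφ : ∀ j, IsUnitVec (φ j)) :
    IsUnitVec (prodVec φ) := by
  rw [IsUnitVec]
  simp only [prodVec, norm_prod, ← Finset.prod_pow]
  rw [sum_prod_eq_prod_sum fun j v => ‖φ j v‖ ^ 2]
  exact Finset.prod_eq_one fun j _ => hφ j

lemma traceLeft_proj_diagPurification {P : Reg d n → ℝ} (hP : ∀ x, 0 ≤ P x)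
    (U : Matrix (Reg d n) (Reg d n) ℂ) :
    traceLeft (proj fun p => ∑ i, U p.2 i * diagPurification P (p.1, i)) =
      U * diagonal (fun x => (P x : ℂ)) * Uᴴ := by
  ext x y
  rw [traceLeft_proj_apply, Matrix.mul_apply]
  refine Finset.sum_congr rfl fun r _ => ?_
  simp only [diagPurification, mul_ite, mul_zero, Finset.sum_ite_eq, Finset.mem_univ, if_true,
    Matrix.mul_diagonal, conjTranspose_apply, star_mul']
  have : star (√(P r) : ℂ) * (√(P r) : ℂ) = (P r : ℂ) := by
    rw [← starRingEnd_apply, Complex.conj_ofReal, ← Complex.ofReal_mul, Real.mul_self_sqrt (hP r)]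
  rw [← this]
  ring

/-- The quantum capacity with a Clifford-rotated product environment is at least the sum of the
label gaps of the factors. -/
theorem sum_labelGap_le_quantumCapacity (h : s ^ 2 + t ^ 2 = 1) (hs : IsUnit s) (ht : IsUnit t)
    {P : Fin n → ZMod d → ℝ} (hP : ∀ j x, 0 ≤ P j x) (hP1 : ∀ j, ∑ x, P j x = 1)
    {φ : Fin n → ZMod d → ℂ} (hφ : ∀ j, IsUnitVec (φ j))
    {U : Matrix (Reg d n) (Reg d n) ℂ} (hU : IsClifford U) :
    Tendsto (capacityRate (beamSplitterChannel s t (U * proj (prodVec φ) * Uᴴ))) atTop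
        (𝓝 (quantumCapacity (beamSplitterChannel s t (U * proj (prodVec φ) * Uᴴ)))) ∧
      (∑ j, labelGap h (P j) fun v => ‖φ j v‖ ^ 2) / Real.log 2 ≤
        quantumCapacity (beamSplitterChannel s t (U * proj (prodVec φ) * Uᴴ)) := by
  rw [conj_proj]
  have hK := hasKraus_beamSplitterChannel h (isUnitVec_mulVec hU.1 (isUnitVec_prodVec hφ))
  obtain ⟨A, hA, B, hB, hAB⟩ := hU.exists_beamSplitter_mul_kronecker h
  have hlim := hK.tendsto_capacityRate
  refine ⟨hlim.1, le_trans ?_ hlim.2⟩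
  -- The witness is the diagonal product input rotated by `U`.
  rw [← coherentInfo_prod h hs ht hP hP1 hφ, ← coherentInfo_mulVec h hA hB hAB]
  refine hK.coherentInfo_le_oneShotCapacity_tensorPow_one ?_ rfl
  have hP' : ∀ x : Reg d n, 0 ≤ ∏ j, P j (x j) := fun x => Finset.prod_nonneg fun j _ => hP j _
  rw [traceLeft_proj_diagPurification hP']
  refine ⟨PosSemidef.mul_mul_conjTranspose_same (PosSemidef.diagonal fun x => ?_) U, ?_⟩
  · change (0 : ℂ) ≤ _
    exact_mod_cast hP' x
  · rw [Matrix.mul_assoc, trace_mul_comm, Matrix.mul_assoc,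
      show Uᴴ * U = 1 from mem_unitaryGroup_iff'.mp hU.1, Matrix.mul_one, trace_diagonal,
      ← Complex.ofReal_sum, sum_prod_eq_prod_sum]
    simp [hP1]

end ProductInput

/-! ### Laws of functions of uniform variables -/

section PointLaw

variable {ι κ V : Type} [Fintype ι] [Fintype κ] [Fintype V] [DecidableEq V] [DecidableEq κ]

/-- The law of `f x`, for `x` uniformly distributed. -/
def pointLaw (f : ι → V) (v : V) : ℝ := ∑ x, if f x = v then (Fintype.card ι : ℝ)⁻¹ else 0

lemma pointLaw_nonneg (f : ι → V) (v : V) : 0 ≤ pointLaw f v :=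
  Finset.sum_nonneg fun x _ => by split_ifs <;> positivity

lemma sum_pointLaw [Nonempty ι] (f : ι → V) : ∑ v, pointLaw f v = 1 := by
  simp only [pointLaw]
  rw [Finset.sum_comm]
  simp

lemma pointLaw_eq_card (f : ι → V) (v : V) :
    pointLaw f v = (Finset.univ.filter fun x => f x = v).card / Fintype.card ι := by
  rw [pointLaw, ← Finset.sum_filter, Finset.sum_const, nsmul_eq_mul, div_eq_mul_inv]

lemma pointLaw_eq_zero_iff (f : ι → V) (v : V) : pointLaw f v = 0 ↔ ∀ x, f x ≠ v := by
  rw [pointLaw_eq_card]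
  constructor
  · intro h x hx
    rw [div_eq_zero_iff] at h
    rcases h with h | h
    · have h' : (Finset.univ.filter fun x => f x = v).card = 0 := by exact_mod_cast h
      rw [Finset.card_eq_zero] at h'
      exact Finset.notMem_empty x (h' ▸ Finset.mem_filter.mpr ⟨Finset.mem_univ x, hx⟩)
    · have h' : Fintype.card ι = 0 := by exact_mod_cast h
      exact (Fintype.card_eq_zero_iff.mp h').false x
  · intro h
    simp [h]

/-- Entropy depends only on which values coincide, so it can be counted on a small index type
independent of `d`. -/
lemma sum_negMulLog_pointLaw_comp (k : ι → κ) {e : κ → V} (he : Function.Injective e) :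
    ∑ v, Real.negMulLog (pointLaw (fun x => e (k x)) v) =
      ∑ i, Real.negMulLog (pointLaw k i) := by
  symm
  refine Fintype.sum_of_injective e he _ _ ?_ ?_
  · intro v hv
    rw [(pointLaw_eq_zero_iff _ v).mpr fun x hx => hv ⟨k x, hx⟩, Real.negMulLog_zero]
  · intro i
    simp only [pointLaw, he.eq_iff]

variable {d : ℕ} [NeZero d] {s t : ZMod d}

lemma ite_rotation_mul_ite (h : s ^ 2 + t ^ 2 = 1) (i j v w : ZMod d) (a b : ℝ) :
    ((if i = (rotation (ZMod d) h (v, w)).1 then a else 0) *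
        if j = (rotation (ZMod d) h (v, w)).2 then b else 0) =
      if s * i + t * j = v then (if -(t * i) + s * j = w then a * b else 0) else 0 := by
  rw [ite_zero_mul_ite_zero, ← ite_and]
  have : (i = (rotation (ZMod d) h (v, w)).1 ∧ j = (rotation (ZMod d) h (v, w)).2) ↔
      (s * i + t * j = v ∧ -(t * i) + s * j = w) := by
    rw [← Prod.ext_iff (x := (i, j)), ← Equiv.symm_apply_eq, Prod.ext_iff]
    rfl
  simp only [this]

lemma outLaw_pointLaw (h : s ^ 2 + t ^ 2 = 1) (f : ι → ZMod d) (g : κ → ZMod d) :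
    outLaw h (pointLaw f) (pointLaw g) =
      pointLaw fun p : ι × κ => s * f p.1 + t * g p.2 := by
  ext v
  simp only [outLaw, pointLaw, Finset.sum_mul_sum, Fintype.sum_prod_type, Fintype.card_prod,
    ite_rotation_mul_ite]
  rw [Finset.sum_comm]
  refine Finset.sum_congr rfl fun x _ => ?_
  rw [Finset.sum_comm]
  refine Finset.sum_congr rfl fun y _ => ?_
  rw [Finset.sum_ite_irrel, Finset.sum_ite_eq, if_pos (Finset.mem_univ _),
    Finset.sum_const_zero, Nat.cast_mul, mul_inv]

lemma envLaw_pointLaw (h : s ^ 2 + t ^ 2 = 1) (f : ι → ZMod d) (g : κ → ZMod d) :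
    envLaw h (pointLaw f) (pointLaw g) =
      pointLaw fun p : ι × κ => -(t * f p.1) + s * g p.2 := by
  ext w
  simp only [envLaw, pointLaw, Finset.sum_mul_sum, Fintype.sum_prod_type, Fintype.card_prod,
    ite_rotation_mul_ite]
  rw [Finset.sum_comm]
  refine Finset.sum_congr rfl fun x _ => ?_
  rw [Finset.sum_comm]
  refine Finset.sum_congr rfl fun y _ => ?_
  rw [Finset.sum_ite_eq, if_pos (Finset.mem_univ _), Nat.cast_mul, mul_inv]

/-- The label gap for uniform inputs, computed from the coincidence patterns of the output and
environment labels. -/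
lemma labelGap_pointLaw {K L : Type} [Fintype K] [Fintype L] [DecidableEq K] [DecidableEq L]
    (h : s ^ 2 + t ^ 2 = 1) (f : ι → ZMod d) (g : κ → ZMod d) (k : ι × κ → K) (l : ι × κ → L)
    {e : K → ZMod d} {e' : L → ZMod d} (he : Function.Injective e) (he' : Function.Injective e')
    (hk : ∀ p : ι × κ, s * f p.1 + t * g p.2 = e (k p))
    (hl : ∀ p : ι × κ, -(t * f p.1) + s * g p.2 = e' (l p)) :
    labelGap h (pointLaw f) (pointLaw g) =
      ∑ i, Real.negMulLog (pointLaw k i) - ∑ i, Real.negMulLog (pointLaw l i) := by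
  rw [labelGap, outLaw_pointLaw, envLaw_pointLaw]
  simp only [hk, hl]
  rw [sum_negMulLog_pointLaw_comp k he, sum_negMulLog_pointLaw_comp l he']

/-- The vector with nonnegative amplitudes whose label distribution is the law of `g`. -/
def sqrtLawVec (g : κ → ZMod d) : ZMod d → ℂ := fun v => (√(pointLaw g v) : ℂ)

lemma norm_sq_sqrtLawVec (g : κ → ZMod d) (v : ZMod d) :
    ‖sqrtLawVec g v‖ ^ 2 = pointLaw g v := by
  rw [sqrtLawVec, Complex.norm_real, Real.norm_of_nonneg (Real.sqrt_nonneg _),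
    Real.sq_sqrt (pointLaw_nonneg g v)]

lemma isUnitVec_sqrtLawVec [Nonempty κ] (g : κ → ZMod d) : IsUnitVec (sqrtLawVec g) := by
  rw [IsUnitVec]
  simp only [norm_sq_sqrtLawVec]
  exact sum_pointLaw g

lemma sqrtLawVec_eq_zero_iff (g : κ → ZMod d) (v : ZMod d) :
    sqrtLawVec g v = 0 ↔ ∀ y, g y ≠ v := by
  rw [← pointLaw_eq_zero_iff, ← norm_sq_sqrtLawVec]
  simp

end PointLaw

/-! ### A support criterion for magic -/

section Magic

variable {d : ℕ} [Fact d.Prime]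

/-- Equality case of Cauchy–Schwarz, from `‖ψ - zφ‖² = 1 - |z|²` with `z = ⟨φ, ψ⟩`. -/
lemma eq_smul_of_one_le_norm_dotProduct {a : Type} [Fintype a] {φ ψ : a → ℂ} (hφ : IsUnitVec φ)
    (hψ : IsUnitVec ψ) (h : 1 ≤ ‖star φ ⬝ᵥ ψ‖ ^ 2) : ψ = (star φ ⬝ᵥ ψ) • φ := by
  set z := star φ ⬝ᵥ ψ with hz
  have key : ((∑ i, ‖ψ i - z * φ i‖ ^ 2 : ℝ) : ℂ) = 1 - (‖z‖ : ℂ) ^ 2 := by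
    have e1 : ∀ i, ((‖ψ i - z * φ i‖ ^ 2 : ℝ) : ℂ) =
        (‖ψ i‖ ^ 2 : ℝ) - star z * (star (φ i) * ψ i) - z * star (star (φ i) * ψ i) +
          z * star z * (‖φ i‖ ^ 2 : ℝ) := by
      intro i
      push_cast
      rw [← Complex.conj_mul', ← Complex.conj_mul', ← Complex.conj_mul']
      simp only [← starRingEnd_apply, map_sub, map_mul, Complex.conj_conj]
      ring
    have e2 : ∑ i, star (φ i) * ψ i = z := rfl
    rw [Complex.ofReal_sum, Finset.sum_congr rfl fun i _ => e1 i, Finset.sum_add_distrib,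
      Finset.sum_sub_distrib, Finset.sum_sub_distrib, ← Finset.mul_sum, ← Finset.mul_sum,
      ← Finset.mul_sum, ← star_sum, e2, ← Complex.ofReal_sum, ← Complex.ofReal_sum, hφ, hψ,
      ← Complex.mul_conj', ← starRingEnd_apply]
    push_cast
    ring
  have key' : ∑ i, ‖ψ i - z * φ i‖ ^ 2 = 1 - ‖z‖ ^ 2 := by exact_mod_cast key
  have hzero : ∑ i, ‖ψ i - z * φ i‖ ^ 2 = 0 :=
    le_antisymm (by linarith) (Finset.sum_nonneg fun _ _ => sq_nonneg _)
  ext i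
  have := (Finset.sum_eq_zero_iff_of_nonneg fun _ _ => sq_nonneg _).mp hzero i (Finset.mem_univ i)
  rw [sq_eq_zero_iff, norm_eq_zero, sub_eq_zero] at this
  exact this

/-- A one-qudit vector proportional to a stabilizer vector is supported everywhere or at a single
label. -/
lemma not_isStabilizerVec_smul {φ : ZMod d → ℂ} {z : ℂ} (hz : z ≠ 0) {v u u' : ZMod d}
    (hv : φ v = 0) (hu : φ u ≠ 0) (hu' : φ u' ≠ 0) (huu : u ≠ u') :
    ¬ IsStabilizerVec (z • prodVec fun _ : Fin 1 => φ) := by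
  rintro ⟨-, m, pq, hli, -, hstab⟩
  have hne : pq 0 ≠ 0 := hli.ne_zero 0
  obtain ⟨w, hw, hW⟩ := phaseEq_weyl_shiftOp (pq 0).1 (pq 0).2
  have h := hstab 0
  rw [hW, mulVec_smul, smul_smul, smul_mulVec] at h
  have hw0 : (ZMod.stdAddChar (m 0) : ℂ) * w ≠ 0 := by
    rw [← norm_ne_zero_iff, norm_mul, norm_stdAddChar, hw]; norm_num
  set c : ℂ := ZMod.stdAddChar (m 0) * w with hc
  have key : ∀ x : ZMod d,
      c * (ZMod.stdAddChar ((pq 0).1 0 * x) * φ (x - (pq 0).2 0)) = φ x := by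
    intro x
    have h1 := congrFun h fun _ => x
    have h2 : (shiftOp ((pq 0).1, (pq 0).2) *ᵥ prodVec fun _ : Fin 1 => φ) (fun _ => x) =
        ZMod.stdAddChar ((pq 0).1 0 * x) * φ (x - (pq 0).2 0) := by
      rw [mulVec, dotProduct, Finset.sum_eq_single fun _ => x - (pq 0).2 0]
      · have e : (fun _ : Fin 1 => x) = (fun _ => x - (pq 0).2 0) + (pq 0).2 := by
          ext j
          rw [Pi.add_apply, Subsingleton.elim j 0, sub_add_cancel]
        rw [shiftOp, Matrix.of_apply, if_pos e]
        simp [prodVec, dotProduct]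
      · intro y _ hy
        rw [shiftOp, Matrix.of_apply, if_neg, zero_mul]
        intro e
        apply hy
        ext j
        rw [congrFun e j, Pi.add_apply, Subsingleton.elim j 0, add_sub_cancel_right]
      · simp
    simp only [Pi.smul_apply, smul_eq_mul, h2] at h1
    refine mul_left_cancel₀ hz (Eq.trans ?_ (h1.trans ?_))
    · ring
    · simp [prodVec]
  -- Without a shift, the generator is a nontrivial power of `Z` up to phase, and its eigenvectors
  -- sit at one label. With a nonzero shift, the zero at `v` propagates to all labels, `d` being
  -- prime.
  by_cases hb : (pq 0).2 0 = 0
  · have ha : (pq 0).1 0 ≠ 0 := by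
      intro ha
      apply hne
      refine Prod.ext (funext fun j => ?_) (funext fun j => ?_)
      · rw [Subsingleton.elim j 0]; exact ha
      · rw [Subsingleton.elim j 0]; exact hb
    have hchar : ∀ x, φ x ≠ 0 → c * ZMod.stdAddChar ((pq 0).1 0 * x) = 1 := by
      intro x hx
      have h1 := key x
      rw [hb, sub_zero, ← mul_assoc] at h1
      exact mul_right_cancel₀ hx (h1.trans (one_mul _).symm)
    have h1 := mul_left_cancel₀ hw0 ((hchar u hu).trans (hchar u' hu').symm)
    exact huu (mul_left_cancel₀ ha (ZMod.injective_stdAddChar h1))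
  · have hzero : ∀ k : ℕ, φ (v - k * (pq 0).2 0) = 0 := by
      intro k
      induction k with
      | zero => simpa using hv
      | succ k ih =>
        have h1 := key (v - k * (pq 0).2 0)
        have hχ : (ZMod.stdAddChar ((pq 0).1 0 * (v - (k : ZMod d) * (pq 0).2 0)) : ℂ) ≠ 0 := by
          rw [← norm_ne_zero_iff, norm_stdAddChar]; norm_num
        rw [ih] at h1
        rw [← (mul_eq_zero.mp ((mul_eq_zero.mp h1).resolve_left hw0)).resolve_left hχ]
        congr 1
        push_cast
        ring
    apply hu
    rw [← hzero ((v - u) / (pq 0).2 0).val]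
    congr 1
    rw [ZMod.natCast_val, ZMod.cast_id', id, div_mul_cancel₀ _ hb]
    ring

/-- The linear functional `ρ ↦ ⟨Φ|ρ|Φ⟩` is below `1` at every stabilizer state, as equality would
make `Φ` proportional to a stabilizer vector. It is therefore below `1` on the convex hull, but
equals `1` at `Φ`. -/
lemma isMagicVec_of_support {φ : ZMod d → ℂ} (hφ : IsUnitVec φ) {v u u' : ZMod d}
    (hv : φ v = 0) (hu : φ u ≠ 0) (hu' : φ u' ≠ 0) (huu : u ≠ u') : IsMagicVec φ := by
  refine ⟨hφ, fun hmem => ?_⟩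
  set Φ : Reg d 1 → ℂ := prodVec fun _ : Fin 1 => φ with hΦ
  have hΦ1 : IsUnitVec Φ := isUnitVec_prodVec fun _ => hφ
  have hF : ∀ ψ : Reg d 1 → ℂ, (star Φ ⬝ᵥ (proj ψ *ᵥ Φ)).re = ‖star Φ ⬝ᵥ ψ‖ ^ 2 := by
    intro ψ
    have h1 : star Φ ⬝ᵥ (proj ψ *ᵥ Φ) = ((‖star Φ ⬝ᵥ ψ‖ ^ 2 : ℝ) : ℂ) := by
      rw [proj, vecMulVec_mulVec]
      push_cast
      rw [← Complex.mul_conj', starRingEnd_apply, dotProduct_smul, op_smul_eq_mul,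
        star_dotProduct ψ Φ]
    rw [h1, Complex.ofReal_re]
  have hlin : IsLinearMap ℝ fun ρ : Matrix (Reg d 1) (Reg d 1) ℂ =>
      (star Φ ⬝ᵥ (ρ *ᵥ Φ)).re :=
    ⟨fun ρ ρ' => by rw [add_mulVec, dotProduct_add, Complex.add_re], fun c ρ => by
      rw [smul_mulVec, dotProduct_smul, Complex.smul_re]⟩
  have hsub : STAB d 1 ⊆ {ρ | (star Φ ⬝ᵥ (ρ *ᵥ Φ)).re < 1} := by
    refine convexHull_min ?_ (convex_halfSpace_lt hlin 1)
    rintro _ ⟨ψ, hψ, rfl⟩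
    rw [Set.mem_ofPred_eq, hF]
    by_contra! hge
    have hz : star Φ ⬝ᵥ ψ ≠ 0 := by
      intro h0
      rw [h0] at hge
      norm_num at hge
    have hψ2 := hψ
    rw [eq_smul_of_one_le_norm_dotProduct hΦ1 hψ.1 hge] at hψ2
    exact not_isStabilizerVec_smul hz hv hu hu' huu hψ2
  have h1 := hsub hmem
  rw [Set.mem_ofPred_eq, hF] at h1
  have h2 : star Φ ⬝ᵥ Φ = 1 := by
    have h3 : ((∑ i, ‖Φ i‖ ^ 2 : ℝ) : ℂ) = star Φ ⬝ᵥ Φ := by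
      push_cast
      exact Finset.sum_congr rfl fun i _ => (Complex.conj_mul' (Φ i)).symm
    rw [← h3, hΦ1, Complex.ofReal_one]
  rw [h2] at h1
  norm_num at h1

lemma isMagicVec_sqrtLawVec {κ : Type} [Fintype κ] [DecidableEq κ] (g : κ → ZMod d)
    (hcard : Fintype.card κ < d) {y y' : κ} (hy : g y ≠ g y') : IsMagicVec (sqrtLawVec g) := by
  have : Nonempty κ := ⟨y⟩
  obtain ⟨v, hv⟩ : ∃ v, ∀ y, g y ≠ v := by
    by_contra! hsurj
    have := Fintype.card_le_of_surjective g hsurj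
    rw [ZMod.card] at this
    omega
  have hne : ∀ y, sqrtLawVec g (g y) ≠ 0 := fun y h0 => (sqrtLawVec_eq_zero_iff g _).mp h0 y rfl
  exact isMagicVec_of_support (isUnitVec_sqrtLawVec g) ((sqrtLawVec_eq_zero_iff g v).mpr hv)
    (hne y) (hne y') hy

end Magic

/-! ### Point sets with a dimension-free entropy gap -/

section LabelChoice

variable {d : ℕ} [Fact d.Prime] {s t : ZMod d}

/-- An exhaustive check excludes `2`, `3` and `5`. The bound leaves room for the seven differences
of `{0, 1, 3}`. -/
lemma NontrivialParams.seven_le (h : NontrivialParams s t) : 7 ≤ d := by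
  have hp : d.Prime := Fact.out
  obtain ⟨h1, h2, h3, h4, h5⟩ := h
  by_contra! hd
  have : d = 2 ∨ d = 3 ∨ d = 5 := by
    interval_cases d <;> first | omega | (exfalso; norm_num at hp)
  rcases this with rfl | rfl | rfl <;> revert s t <;> decide

lemma natCast_fin_injective {m : ℕ} (hm : m ≤ d) :
    Function.Injective fun i : Fin m => ((i : ℕ) : ZMod d) := by
  intro i j hij
  have := (ZMod.natCast_eq_natCast_iff' _ _ _).mp hij
  rw [Nat.mod_eq_of_lt (i.2.trans_le hm), Nat.mod_eq_of_lt (j.2.trans_le hm)] at this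
  exact Fin.ext this

lemma mul_natCast_sub_injective {m : ℕ} (hm : m ≤ d) {u : ZMod d} (hu : u ≠ 0) (w : ZMod d) :
    Function.Injective fun i : Fin m => u * (((i : ℕ) : ZMod d) - w) := by
  intro i j hij
  exact natCast_fin_injective hm (sub_left_injective (mul_left_cancel₀ hu hij))

/-- If `s² ≠ t²`, two-point inputs give four distinct output labels and only three environment
labels. -/
lemma labelGap_two_points (h : NontrivialParams s t) (hst : s ^ 2 ≠ t ^ 2) :
    labelGap h.1 (pointLaw fun x : Fin 2 => s * ((x : ℕ) : ZMod d))
      (pointLaw fun y : Fin 2 => t * ((y : ℕ) : ZMod d)) = Real.log 2 / 2 := by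
  have hd := h.seven_le
  have h1 := h.1
  obtain ⟨-, hs0, hs1, ht0, ht1⟩ := h
  have hs : s ≠ 0 := fun e => hs0 (by rw [e]; ring)
  have ht : t ≠ 0 := fun e => ht0 (by rw [e]; ring)
  -- The offset `1` moves the differences `-1, 0, 1` into `Fin 3`, and `e'` undoes it.
  rw [labelGap_pointLaw h1 _ _ (id : Fin 2 × Fin 2 → Fin 2 × Fin 2)
    (L := Fin 3) (fun p : Fin 2 × Fin 2 => (p.2.castSucc - p.1.castSucc + 1 : Fin 3))
    (e := fun p => s ^ 2 * ((p.1 : ℕ) : ZMod d) + t ^ 2 * ((p.2 : ℕ) : ZMod d))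
    (e' := fun i => s * t * (((i : ℕ) : ZMod d) - 1)) ?_
    (mul_natCast_sub_injective (by omega) (mul_ne_zero hs ht) 1)]
  -- The entropies are `2 log 2` for the output and `(3/2) log 2` for the environment.
  · have c1 : ∀ i : Fin 2 × Fin 2, (Finset.univ.filter fun x => id x = i).card = 1 := by decide
    have c2 : ∀ i : Fin 3, (Finset.univ.filter fun p : Fin 2 × Fin 2 =>
        (p.2.castSucc - p.1.castSucc + 1 : Fin 3) = i).card = ![1, 2, 1] i := by decide
    have l2 : Real.log (1 / 2) = -Real.log 2 := by rw [one_div, Real.log_inv]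
    have l4 : Real.log (1 / 4) = -(2 * Real.log 2) := by
      rw [one_div, Real.log_inv, show (4 : ℝ) = 2 ^ 2 by norm_num, Real.log_pow]; norm_num
    simp only [pointLaw_eq_card, c1, c2, Fin.sum_univ_succ]
    norm_num [Fin.succ, Real.negMulLog, l2, l4]
    ring
  · intro p
    simp only [id]
    ring
  · have hl : ∀ p : Fin 2 × Fin 2, (((p.2.castSucc - p.1.castSucc + 1 : Fin 3) : ℕ) : ℤ) =
        ((p.2 : ℕ) : ℤ) - ((p.1 : ℕ) : ℤ) + 1 := by decide
    intro p
    have := congrArg (Int.cast : ℤ → ZMod d) (hl p)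
    push_cast at this
    rw [this]
    ring
  -- The labels `0`, `s²`, `t²` and `s² + t² = 1` are distinct.
  · rintro ⟨i, j⟩ ⟨i', j'⟩ hij
    have h2 : ¬ (0 : ZMod d) = t ^ 2 := fun e => ht0 e.symm
    have h3 : ¬ (0 : ZMod d) = s ^ 2 := fun e => hs0 e.symm
    have h4 : ¬ t ^ 2 = s ^ 2 := fun e => hst e.symm
    fin_cases i <;> fin_cases j <;> fin_cases i' <;> fin_cases j' <;>
      simp_all

/-- The set `{0, 1, 3}`, which has more differences than sums. -/
def sidonLabel : Fin 3 → Fin 4 := ![0, 1, 3]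

/-- If `s² = t²`, inputs on `{0, 1, 3}` give differences as output labels and sums as environment
labels. -/
lemma labelGap_three_points (h : NontrivialParams s t) (hst : s ^ 2 = t ^ 2) :
    labelGap h.1 (pointLaw fun x : Fin 3 => s * ((sidonLabel x : ℕ) : ZMod d))
      (pointLaw fun y : Fin 3 => -t * ((sidonLabel y : ℕ) : ZMod d)) =
      (2 * Real.log 2 - Real.log 3) / 3 := by
  have hd := h.seven_le
  have h1 := h.1
  obtain ⟨-, hs0, hs1, ht0, ht1⟩ := h
  have hs : s ≠ 0 := fun e => hs0 (by rw [e]; ring)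
  have ht : t ≠ 0 := fun e => ht0 (by rw [e]; ring)
  -- The offset `3` moves the differences `-3, …, 3` into `Fin 7`; labels are at most `3`, so the
  -- natural subtraction does not truncate.
  rw [labelGap_pointLaw h1 _ _
    (fun p : Fin 3 × Fin 3 => (Fin.ofNat 7 (sidonLabel p.1 + 3 - sidonLabel p.2) : Fin 7))
    (fun p : Fin 3 × Fin 3 => (Fin.ofNat 7 (sidonLabel p.1 + sidonLabel p.2) : Fin 7))
    (mul_natCast_sub_injective hd hs0 3)
    (mul_natCast_sub_injective hd (neg_ne_zero.mpr (mul_ne_zero hs ht)) 0)]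
  -- The differences have entropy `(5/3) log 3` and the sums `2 log 3 - (2/3) log 2`.
  · have c1 : ∀ i : Fin 7, (Finset.univ.filter fun p : Fin 3 × Fin 3 =>
        (Fin.ofNat 7 (sidonLabel p.1 + 3 - sidonLabel p.2) : Fin 7) = i).card =
        ![1, 1, 1, 3, 1, 1, 1] i := by decide
    have c2 : ∀ i : Fin 7, (Finset.univ.filter fun p : Fin 3 × Fin 3 =>
        (Fin.ofNat 7 (sidonLabel p.1 + sidonLabel p.2) : Fin 7) = i).card =
        ![1, 2, 1, 2, 2, 0, 1] i := by decide
    have l9 : Real.log 9 = 2 * Real.log 3 := by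
      rw [show (9 : ℝ) = 3 ^ 2 by norm_num, Real.log_pow]; norm_num
    have l19 : Real.log (1 / 9) = -(2 * Real.log 3) := by rw [one_div, Real.log_inv, l9]
    have l13 : Real.log (1 / 3) = -Real.log 3 := by rw [one_div, Real.log_inv]
    have l29 : Real.log (2 / 9) = Real.log 2 - 2 * Real.log 3 := by
      rw [Real.log_div (by norm_num) (by norm_num), l9]
    simp only [pointLaw_eq_card, c1, c2, Fin.sum_univ_succ]
    norm_num [Fin.succ, Real.negMulLog, l19, l13, l29]
    ring
  · have hl : ∀ p : Fin 3 × Fin 3,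
        (((Fin.ofNat 7 (sidonLabel p.1 + 3 - sidonLabel p.2) : Fin 7) : ℕ) : ℤ) =
          ((sidonLabel p.1 : ℕ) : ℤ) - ((sidonLabel p.2 : ℕ) : ℤ) + 3 := by decide
    intro p
    have := congrArg (Int.cast : ℤ → ZMod d) (hl p)
    push_cast at this
    rw [this]
    linear_combination ((sidonLabel p.2 : ℕ) : ZMod d) * hst
  · have hl : ∀ p : Fin 3 × Fin 3,
        ((Fin.ofNat 7 (sidonLabel p.1 + sidonLabel p.2) : Fin 7) : ℕ) =
          (sidonLabel p.1 : ℕ) + (sidonLabel p.2 : ℕ) := by decide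
    intro p
    have := congrArg (Nat.cast : ℕ → ZMod d) (hl p)
    push_cast at this
    rw [this]
    ring

/-- For all nontrivial parameters, the label gap `(2 log 2 - log 3) / 3` is available. -/
lemma exists_labelGap_ge (h : NontrivialParams s t) :
    ∃ (m : ℕ) (f g : Fin m → ZMod d) (y y' : Fin m), m < d ∧ g y ≠ g y' ∧
      (2 * Real.log 2 - Real.log 3) / 3 ≤ labelGap h.1 (pointLaw f) (pointLaw g) := by
  have hd := h.seven_le
  have ht : t ≠ 0 := fun e => h.2.2.2.1 (by rw [e]; ring)
  by_cases hst : s ^ 2 = t ^ 2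
  · refine ⟨3, _, _, 0, 1, by omega, ?_, (labelGap_three_points h hst).ge⟩
    simp [sidonLabel, ht]
  · refine ⟨2, fun x => s * ((x : ℕ) : ZMod d), fun y => t * ((y : ℕ) : ZMod d), 0, 1, by omega,
      by simp [ht.symm], ?_⟩
    rw [labelGap_two_points h hst]
    have : Real.log 2 ≤ Real.log 3 := Real.log_le_log (by norm_num) (by norm_num)
    have : 0 < Real.log 2 := Real.log_pos (by norm_num)
    linarith

/-- For the padding qudits: with both inputs at `0`, both outgoing labels are constant. -/
lemma labelGap_basis (h : s ^ 2 + t ^ 2 = 1) :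
    labelGap h (pointLaw fun _ : Fin 1 => 0) (pointLaw fun _ : Fin 1 => 0) = 0 := by
  rw [labelGap_pointLaw h _ _ (id : Fin 1 × Fin 1 → _) (id : Fin 1 × Fin 1 → _)
    (e := fun _ => 0) (e' := fun _ => 0) (Function.injective_of_subsingleton _)
    (Function.injective_of_subsingleton _) (by simp) (by simp), sub_self]

end LabelChoice

end QuditBeamSplitter

end

open QuditBeamSplitter

/-! ### Assembly of the capacity bound -/

theorem theorem3 :
    ∃ c : ℝ, 0 < c ∧
      ∀ (d : ℕ) [Fact d.Prime] (s t : ZMod d), NontrivialParams s t →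
        ∃ φ : ZMod d → ℂ, IsMagicVec φ ∧
          ∀ (n k : ℕ), k ≤ n →
            ∀ U : Matrix (Reg d n) (Reg d n) ℂ, IsClifford U →
              Tendsto (capacityRate (beamSplitterChannel s t (U * proj (paddedVec n k φ) * Uᴴ)))
                atTop
                (𝓝 (quantumCapacity
                  (beamSplitterChannel s t (U * proj (paddedVec n k φ) * Uᴴ)))) ∧
              (k : ℝ) * c ≤ quantumCapacity
                (beamSplitterChannel s t (U * proj (paddedVec n k φ) * Uᴴ)) := by
  have hlog2 : 0 < Real.log 2 := Real.log_pos (by norm_num)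
  have hgap : 0 < (2 * Real.log 2 - Real.log 3) / 3 := by
    have h4 : Real.log 3 < Real.log (2 ^ 2) := Real.log_lt_log (by norm_num) (by norm_num)
    rw [Real.log_pow] at h4
    push_cast at h4
    linarith
  -- The smaller of the two gaps, in bits: `(2 - log₂ 3) / 3`, positive since `3 < 4`.
  refine ⟨(2 * Real.log 2 - Real.log 3) / 3 / Real.log 2, div_pos hgap hlog2, ?_⟩
  intro d _ s t hst
  obtain ⟨m, f, g, y, y', hm, hy, hfg⟩ := exists_labelGap_ge hst
  have hne : Nonempty (Fin m) := ⟨y⟩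
  refine ⟨sqrtLawVec g, isMagicVec_sqrtLawVec g (by simpa using hm) hy, ?_⟩
  intro n k hk U hU
  have hs : s ≠ 0 := fun e => hst.2.1 (by rw [e]; ring)
  have ht : t ≠ 0 := fun e => hst.2.2.2.1 (by rw [e]; ring)
  -- Input law before the Clifford rotation: the gap-producing law opposite each magic qudit, a
  -- point mass at `0` opposite each `|0⟩`.
  let P : Fin n → ZMod d → ℝ := fun j =>
    if (j : ℕ) < k then pointLaw f else pointLaw fun _ : Fin 1 => 0
  have hbasis : ∀ v : ZMod d, ‖(Pi.single 0 1 : ZMod d → ℂ) v‖ ^ 2 =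
      pointLaw (fun _ : Fin 1 => (0 : ZMod d)) v := by
    intro v
    by_cases hv : v = 0
    · subst hv; simp [pointLaw]
    · have hv' : ¬ 0 = v := fun e => hv e.symm
      simp [pointLaw, hv, hv']
  have hmain := sum_labelGap_le_quantumCapacity (n := n) hst.1 hs.isUnit ht.isUnit (P := P)
    (φ := fun j => if (j : ℕ) < k then sqrtLawVec g else Pi.single 0 1)
    (fun j x => by dsimp only [P]; split_ifs <;> exact pointLaw_nonneg _ _)
    (fun j => by dsimp only [P]; split_ifs <;> exact sum_pointLaw _)
    (fun j => by
      split_ifs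
      · exact isUnitVec_sqrtLawVec g
      · rw [IsUnitVec]
        simp only [hbasis]
        exact sum_pointLaw _) hU
  refine ⟨hmain.1, le_trans ?_ hmain.2⟩
  have hterm : ∀ j : Fin n, (if (j : ℕ) < k then (2 * Real.log 2 - Real.log 3) / 3 else 0) ≤
      labelGap hst.1 (P j) fun v => ‖(if (j : ℕ) < k then sqrtLawVec g else Pi.single 0 1) v‖ ^ 2 := by
    intro j
    by_cases hj : (j : ℕ) < k
    · simp only [P, if_pos hj, norm_sq_sqrtLawVec]
      exact hfg
    · simp only [P, if_neg hj, hbasis]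
      exact (labelGap_basis hst.1).ge
  have hsum := Finset.sum_le_sum fun (j : Fin n) (_ : j ∈ Finset.univ) => hterm j
  have hcount : ∑ j : Fin n, (if (j : ℕ) < k then (2 * Real.log 2 - Real.log 3) / 3 else 0) =
      k * ((2 * Real.log 2 - Real.log 3) / 3) := by
    rw [← Finset.sum_filter, Finset.sum_const, nsmul_eq_mul, Fin.card_filter_val_lt,
      min_eq_right hk]
  rw [hcount] at hsum
  rw [← mul_div_assoc]
  exact div_le_div_of_nonneg_right hsum hlog2.le
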